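/- Let $\mathbb K=\mathbb R$ or $\mathbb C$, let $n\ge 0$, and regard $\mathbb P^n=\mathbb P^n(\mathbb K)$ as a real algebraic manifold. Semialgebraic sets, differentials and dimensions are meant in the real sense, smooth means $C^1$, and $\dim\emptyset=-\infty$. Let $\mathcal S$ be an algebraic stratification of $\mathbb P^n$: a finite partition of $\mathbb P^n$ into smooth semialgebraic submanifolds (strata) that are the connected components of the sets $X_j\setminus X_{j-1}$, $0\le j\le n$, for a filtration $\mathbb P^n=X_n\supset X_{n-1}\supset\dots\supset X_0\supset X_{-1}=\emptyset$ by algebraic subsets over $\mathbb K$ such that, for each $j$, either $\dim_{\mathbb K}X_j=j$ or $X_j=X_{j-1}$, and $\operatorname{Sing}(X_j)\subset X_{j-1}$. Let $U$ be an open semialgebraic neighborhood of $0$ in $\mathbb K^{n+1}$ and let $\Psi:U\times\mathbb P^n\to\mathbb P^n$, $\Psi_t(x)=\Psi(t,x)$, be a semialgebraic map with $\Psi(0,x)=x$ for all $x$ that is a stratified submersive family of diffeomorphisms with respect to $\mathcal S$; that is, for every stratum $S\in\mathcal S$ we have $\Psi(U\times S)\subset S$, the map $\Psi:U\times S\to S$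 is $C^1$, $\Psi_t:S\to S$ is a $C^1$ diffeomorphism for every $t\in U$, and for all $(t,x)\in U\times S$ the differential at $t$ of the map $U\to S$, $\tau\mapsto\Psi(\tau,x)$, is onto the tangent space of $S$ at $\Psi(t,x)$. Let $Z$ and $W$ be semialgebraic subsets of $\mathbb P^n$. Then there is an open dense semialgebraic subset $U'$ of $U$ such that, for all $t\in U'$ and all strata $S\in\mathcal S$, $$\dim\bigl(Z\cap\Psi_t^{-1}(W)\cap S\bigr)\le\dim(Z\cap S)+\dim(W\cap S)-\dim S .$$ -/

import Mathlib

open Set Module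
open scoped Topology

noncomputable section

/-! ### Semialgebraic sets and their dimension in a real vector space -/

/-- The ring of polynomial functions on a subset `A` of a real vector space `E`: the algebra of
functions on `A` generated by the constants and the restrictions of the linear forms on `E`.
When `E = ℝ ^ N` this is `ℝ[x₁, …, x_N] / I(A)`. -/
def polyFunctionsOn {E : Type*} [AddCommGroup E] [Module ℝ E] (A : Set E) :
    Subalgebra ℝ (A → ℝ) :=
  Algebra.adjoin ℝ (range fun (l : E →ₗ[ℝ] ℝ) (a : A) => l a)

/-- Semialgebraic subsets of a real vector space: the Boolean algebra of sets generated by the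
sets `{f > 0}` with `f` a polynomial function. -/
inductive IsSemialgebraic {E : Type*} [AddCommGroup E] [Module ℝ E] : Set E → Prop
  | pos (f : E → ℝ) (hf : f ∈ Algebra.adjoin ℝ (range fun (l : E →ₗ[ℝ] ℝ) (x : E) => l x)) :
      IsSemialgebraic {x | 0 < f x}
  | compl (A : Set E) : IsSemialgebraic A → IsSemialgebraic Aᶜ
  | union (A B : Set E) : IsSemialgebraic A → IsSemialgebraic B → IsSemialgebraic (A ∪ B)

/-- The dimension of a (semialgebraic) set: the Krull dimension of its ring of polynomial
functions. It is `⊥` (that is, `-∞`) for the empty set. -/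
def semialgDim {E : Type*} [AddCommGroup E] [Module ℝ E] (A : Set E) : WithBot ℕ∞ :=
  ringKrullDim (polyFunctionsOn A)

/-! ### `C¹` submanifolds of a real normed space -/

/-- `A` is an embedded `C¹` submanifold of `E`, of pure dimension `d`: near each of its points it
is the zero set of a `C¹` submersion onto `ℝ ^ m`, where `m + d = dim E`. -/
def IsC1Submanifold {E : Type*} [NormedAddCommGroup E] [NormedSpace ℝ E] (d : ℕ) (A : Set E) :
    Prop :=
  ∀ x ∈ A, ∃ (m : ℕ) (O : Set E) (g : E → Fin m → ℝ), m + d = finrank ℝ E ∧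
    IsOpen O ∧ x ∈ O ∧ ContDiffOn ℝ 1 g O ∧ Function.Surjective (fderiv ℝ g x) ∧
    A ∩ O = {y ∈ O | g y = 0}

/-- The tangent space at `x` of a submanifold `A` of `E`, as a subspace of `E`. -/
def tangentSpaceOf {E : Type*} [NormedAddCommGroup E] [NormedSpace ℝ E] (A : Set E) (x : E) :
    Submodule ℝ E :=
  Submodule.span ℝ (tangentConeAt ℝ A x)

/-! ### Projective space as a real algebraic manifold -/

/-- The projective space `ℙⁿ` over `𝕜`. -/
abbrev ProjSpace (𝕜 : Type*) [RCLike 𝕜] (n : ℕ) : Type _ :=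
  Projectivization 𝕜 (Fin (n + 1) → 𝕜)

/-- The real vector space of square matrices of size `n + 1` over `𝕜`. -/
abbrev MatSpace (𝕜 : Type*) (n : ℕ) : Type _ :=
  Fin (n + 1) → Fin (n + 1) → 𝕜

/-- The standard closed embedding of `ℙⁿ` as a real algebraic submanifold of the space of
matrices: the line spanned by `v` goes to the matrix `v v* / |v|²` of the orthogonal projection
onto it (any nonzero `v` on the line gives the same matrix, see `projEmb_mk`). The topology, the
real manifold structure and the semialgebraic structure of `ℙⁿ` are those induced by this
embedding; they agree with the ones given by the affine charts. -/
def projEmb {𝕜 : Type*} [RCLike 𝕜] {n : ℕ} (x : ProjSpace 𝕜 n) : MatSpace 𝕜 n :=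
  fun i j => x.rep i * star (x.rep j) / ∑ k, x.rep k * star (x.rep k)

theorem projEmb_mk {𝕜 : Type*} [RCLike 𝕜] {n : ℕ} (v : Fin (n + 1) → 𝕜) (hv : v ≠ 0) :
    projEmb (Projectivization.mk 𝕜 v hv) =
      fun i j => v i * star (v j) / ∑ k, v k * star (v k) := by
  obtain ⟨a, ha⟩ := Projectivization.exists_smul_eq_mk_rep 𝕜 v hv
  have ha' : (a : 𝕜) * star (a : 𝕜) ≠ 0 := mul_ne_zero a.ne_zero (star_ne_zero.2 a.ne_zero)
  have hr : ∀ i, (Projectivization.mk 𝕜 v hv).rep i = a * v i := fun i => by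
    rw [← ha]; rfl
  have hm : ∀ i j, (a : 𝕜) * v i * star ((a : 𝕜) * v j) =
      (a * star (a : 𝕜)) * (v i * star (v j)) := fun i j => by
    rw [star_mul']; ring
  funext i j
  simp only [projEmb, hr, hm, ← Finset.mul_sum]
  exact mul_div_mul_left _ _ ha'

theorem projEmb_injective {𝕜 : Type*} [RCLike 𝕜] {n : ℕ} :
    Function.Injective (projEmb : ProjSpace 𝕜 n → MatSpace 𝕜 n) := by
  intro x y h
  have hs : ∀ z : ProjSpace 𝕜 n, ∑ k, z.rep k * star (z.rep k) ≠ 0 := fun z h0 => by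
    apply z.rep_nonzero
    have h1 : ∑ k, ‖z.rep k‖ ^ 2 = 0 := by
      have : ((∑ k, ‖z.rep k‖ ^ 2 : ℝ) : 𝕜) = 0 := by
        rw [← h0]; push_cast
        exact Finset.sum_congr rfl fun k _ => (RCLike.mul_conj _).symm
      exact_mod_cast this
    funext k
    have := (Finset.sum_eq_zero_iff_of_nonneg (fun k _ => by positivity)).1 h1 k (Finset.mem_univ k)
    simpa using this
  obtain ⟨j, hj⟩ := Function.ne_iff.1 x.rep_nonzero
  have key : ∀ i, x.rep i * star (x.rep j) / ∑ k, x.rep k * star (x.rep k) =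
      y.rep i * star (y.rep j) / ∑ k, y.rep k * star (y.rep k) := fun i => congrFun (congrFun h i) j
  rw [← x.mk_rep, ← y.mk_rep, Projectivization.mk_eq_mk_iff']
  have hj' : star (x.rep j) ≠ 0 := star_ne_zero.2 hj
  refine ⟨(∑ k, x.rep k * star (x.rep k)) / star (x.rep j) *
    (star (y.rep j) / ∑ k, y.rep k * star (y.rep k)), ?_⟩
  funext i
  have hi := key i
  have h1 := hs x
  have h2 := hs y
  simp only [Pi.smul_apply, smul_eq_mul]
  calc _ = (∑ k, x.rep k * star (x.rep k)) / star (x.rep j) *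
        (y.rep i * star (y.rep j) / ∑ k, y.rep k * star (y.rep k)) := by ring
    _ = x.rep i := by rw [← hi]; field_simp

/-- Semialgebraic subsets of `ℙⁿ`. -/
def IsProjSemialgebraic {𝕜 : Type*} [RCLike 𝕜] {n : ℕ} (A : Set (ProjSpace 𝕜 n)) : Prop :=
  IsSemialgebraic (projEmb '' A)

/-- The (real) dimension of a semialgebraic subset of `ℙⁿ`. -/
def projDim {𝕜 : Type*} [RCLike 𝕜] {n : ℕ} (A : Set (ProjSpace 𝕜 n)) : WithBot ℕ∞ :=
  semialgDim (projEmb '' A)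

/-! ### Algebraic subsets of projective space and their nonsingular points -/

/-- `V` is the common zero set in `ℙⁿ` of a set of homogeneous polynomials over `𝕜`. -/
def IsProjAlgebraic {𝕜 : Type*} [RCLike 𝕜] {n : ℕ} (V : Set (ProjSpace 𝕜 n)) : Prop :=
  ∃ P : Set (MvPolynomial (Fin (n + 1)) 𝕜), (∀ p ∈ P, ∃ e, p.IsHomogeneous e) ∧
    V = {x | ∀ p ∈ P, MvPolynomial.eval x.rep p = 0}

/-- The point `x` of the algebraic set `V` is nonsingular (the local ring of `V` at `x` is regular):
there are homogeneous polynomials over `𝕜` that vanish on `V`, have linearly independent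
differentials at `x`, and define `V` in a neighborhood of `x`. -/
def IsNonsingularAt {𝕜 : Type*} [RCLike 𝕜] {n : ℕ} (V : Set (ProjSpace 𝕜 n))
    (x : ProjSpace 𝕜 n) : Prop :=
  ∃ (m : ℕ) (f : Fin m → MvPolynomial (Fin (n + 1)) 𝕜),
    (∀ i, ∃ e, (f i).IsHomogeneous e) ∧
    (∀ i, ∀ y ∈ V, MvPolynomial.eval y.rep (f i) = 0) ∧
    LinearIndependent 𝕜 (fun i k => MvPolynomial.eval x.rep (MvPolynomial.pderiv k (f i))) ∧
    ∃ O : Set (MatSpace 𝕜 n), IsOpen O ∧ projEmb x ∈ O ∧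
      ∀ y, projEmb y ∈ O → (∀ i, MvPolynomial.eval y.rep (f i) = 0) → y ∈ V

/-! ### Stratifications -/

/-- A stratification of `ℙⁿ`: a partition into smooth semialgebraic manifolds. As `ℙⁿ` is compact,
a locally finite partition is finite. -/
structure IsStratification {𝕜 : Type*} [RCLike 𝕜] {n : ℕ} (𝒮 : Set (Set (ProjSpace 𝕜 n))) :
    Prop where
  isPartition : Setoid.IsPartition 𝒮
  finite : 𝒮.Finite
  semialgebraic : ∀ S ∈ 𝒮, IsProjSemialgebraic S
  smooth : ∀ S ∈ 𝒮, ∃ d, IsC1Submanifold d (projEmb '' S)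

/-- An algebraic stratification of `ℙⁿ`: a stratification that comes from a filtration
`ℙⁿ = X n ⊇ X (n - 1) ⊇ … ⊇ X 0 ⊇ X (-1) = ∅` by algebraic subsets such that, for each `j`,
either `X j` has dimension `j` over `𝕜` (real dimension `j` or `2 j`) or `X j = X (j - 1)`, and
the singular points of `X j` lie in `X (j - 1)`. The strata are the connected components of the
sets `X j \ X (j - 1)`. -/
structure IsAlgebraicStratification {𝕜 : Type*} [RCLike 𝕜] {n : ℕ}
    (𝒮 : Set (Set (ProjSpace 𝕜 n))) : Prop extends IsStratification 𝒮 where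
  exists_filtration : ∃ X : ℤ → Set (ProjSpace 𝕜 n), X (-1) = ∅ ∧ X n = univ ∧
    (∀ j : ℕ, j ≤ n → IsProjAlgebraic (X j) ∧ X (j - 1) ⊆ X j ∧
      (projDim (X j) = ((finrank ℝ 𝕜 * j : ℕ) : WithBot ℕ∞) ∨ X j = X (j - 1)) ∧
      ∀ x ∈ X j, ¬ IsNonsingularAt (X j) x → x ∈ X (j - 1)) ∧
    ∀ S : Set (ProjSpace 𝕜 n), S ∈ 𝒮 ↔ ∃ j : ℕ, j ≤ n ∧ ∃ x ∈ X j \ X (j - 1),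
      projEmb '' S = connectedComponentIn (projEmb '' (X j \ X (j - 1))) (projEmb x)

/-! ### Stratified submersive families of diffeomorphisms -/

/-- `Ψ` restricts to a submersive family of diffeomorphisms `U × S → S` of the submanifold `S` of
`ℙⁿ`, with parameters in the open set `U` of `𝕜 ^ (n + 1)`. -/
structure IsSubmersiveFamily {𝕜 : Type*} [RCLike 𝕜] {n : ℕ} (U : Set (Fin (n + 1) → 𝕜))
    (S : Set (ProjSpace 𝕜 n)) (Ψ : (Fin (n + 1) → 𝕜) → ProjSpace 𝕜 n → ProjSpace 𝕜 n) :
    Prop where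
  mapsTo : ∀ t ∈ U, MapsTo (Ψ t) S S
  /-- `Ψ : U × S → S` is of class `C¹`. -/
  smooth : ∃ G : (Fin (n + 1) → 𝕜) × MatSpace 𝕜 n → MatSpace 𝕜 n,
    ContDiffOn ℝ 1 G (U ×ˢ (projEmb '' S)) ∧
    ∀ t ∈ U, ∀ x ∈ S, G (t, projEmb x) = projEmb (Ψ t x)
  /-- `Ψ t : S → S` is bijective, with an inverse of class `C¹`. -/
  bijOn : ∀ t ∈ U, BijOn (Ψ t) S S
  smooth_inv : ∀ t ∈ U, ∃ H : MatSpace 𝕜 n → MatSpace 𝕜 n,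
    ContDiffOn ℝ 1 H (projEmb '' S) ∧ ∀ x ∈ S, H (projEmb (Ψ t x)) = projEmb x
  /-- The differential at `t` of the orbit map `τ ↦ Ψ τ x` is onto the tangent space of `S`. -/
  submersive : ∀ t ∈ U, ∀ x ∈ S,
    LinearMap.range (fderiv ℝ (fun τ => projEmb (Ψ τ x)) t : (Fin (n + 1) → 𝕜) →ₗ[ℝ] MatSpace 𝕜 n) =
      tangentSpaceOf (projEmb '' S) (projEmb (Ψ t x))

/-- The map `Ψ : U × ℙⁿ → ℙⁿ` is semialgebraic: its graph is. -/
def IsSemialgebraicFamily {𝕜 : Type*} [RCLike 𝕜] {n : ℕ} (U : Set (Fin (n + 1) → 𝕜))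
    (Ψ : (Fin (n + 1) → 𝕜) → ProjSpace 𝕜 n → ProjSpace 𝕜 n) : Prop :=
  IsSemialgebraic {p : (Fin (n + 1) → 𝕜) × MatSpace 𝕜 n × MatSpace 𝕜 n |
    p.1 ∈ U ∧ ∃ x, p.2.1 = projEmb x ∧ p.2.2 = projEmb (Ψ p.1 x)}

end

/-! ### Krull dimension and transcendence degree -/

/-! Fix a stratum `S` of dimension `d`, let `m` be the real dimension of the parameter space, and
consider the incidence set `M` of all `(x, y, t)` with `t ∈ U`, `x ∈ Z ∩ S`, `y ∈ W ∩ S` and `y = Ψ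
t x`. Over a fixed `(x, y)` its fiber lies in a level set of the orbit map `τ ↦ Ψ τ x`, whose rank
is at least `d`, so the fiber has dimension at most `m - d` and `dim M ≤ dim (Z ∩ S) + dim (W ∩ S) +
m - d`. Over a fixed `t` the fiber is the graph of `Ψ t` on `Z ∩ Ψ t ⁻¹' W ∩ S`. If these fibers
were too large for a Zariski dense set of parameters, `M` would exceed that bound. The bad
parameters of each stratum therefore lie in the zero set of a nonzero polynomial, and `U'` is the
part of `U` where the product of these finitely many polynomials does not vanish.

The counting needs a workable notion of dimension. By `natCast_le_semialgDim_iff`, the Krull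
dimension is the largest `d` for which some projection to `d` coordinates is Zariski dense. The two
fiber inequalities are `HasCoordDim.of_fibers` (from below) and `HasCoordDim.le_add_of_fibers` (from
above). The link with `C¹` geometry is Hausdorff dimension: a Zariski dense coordinate projection of
a semialgebraic set has interior (`IsTame.interior_image_nonempty`), so the algebraic dimension is
at most `dimH`, and the implicit function theorem bounds `dimH` of a level set
(`dimH_level_le_of_le_finrank_range`).

Quantifier elimination is avoided. Semialgebraic sets are finite unions of locally algebraic sets,
and it is enough that the projection of an irreducible locally algebraic set contains a locally
algebraic set with the same Zariski closure (`IsLocallyAlgebraic.exists_subset_image_inl`). -/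

/-- An integral extension preserves the Krull dimension. -/
theorem ringKrullDim_eq_of_isIntegral_of_injective {R S : Type*} [CommRing R] [CommRing S]
    [Algebra R S] [Algebra.IsIntegral R S] (hinj : Function.Injective (algebraMap R S)) :
    ringKrullDim S = ringKrullDim R := by
  apply le_antisymm
  · refine Order.krullDim_le_of_strictMono (PrimeSpectrum.comap (algebraMap R S)) ?_
    intro I J hIJ
    exact Ideal.IsIntegral.comap_lt_comap (I := I.asIdeal) (J := J.asIdeal) hIJ
  · refine iSup_le fun l => ?_
    obtain ⟨Q, -, hQ, hQ'⟩ := Ideal.exists_ideal_over_prime_of_isIntegral (S := S)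
      (RelSeries.head l).asIdeal ⊥ (by
        intro x hx
        have : x = 0 := hinj (by simpa using hx)
        simp [this])
    have : Q.LiesOver (RelSeries.head l).asIdeal := ⟨hQ'.symm⟩
    obtain ⟨L, hL, -⟩ := Ideal.exists_ltSeries_of_hasGoingUp l Q
    rw [← hL]
    exact Order.LTSeries.length_le_krullDim L

/-- An algebraically independent family stays algebraically independent modulo some prime. -/
theorem AlgebraicIndependent.exists_isPrime_quotient {k R κ : Type*} [Field k] [CommRing R]
    [Algebra k R] {y : κ → R} (hy : AlgebraicIndependent k y) :
    ∃ q : Ideal R, q.IsPrime ∧ AlgebraicIndependent k fun i => Ideal.Quotient.mk q (y i) := by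
  -- The values at `y` of the nonzero polynomials form a multiplicative set, which misses `0` by
  -- independence. A prime disjoint from it keeps every such value nonzero in the quotient.
  let M : Submonoid R := (nonZeroDivisors (MvPolynomial κ k)).map (MvPolynomial.aeval y)
  have h0 : Disjoint ((⊥ : Ideal R) : Set R) M := by
    rw [Set.disjoint_left]
    rintro x hx ⟨p, hp, rfl⟩
    have hp0 : p = 0 := hy (by simpa using hx)
    exact nonZeroDivisors.ne_zero hp hp0
  obtain ⟨q, hq, -, hdisj⟩ := Ideal.exists_le_prime_disjoint _ _ h0
  refine ⟨q, hq, ?_⟩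
  rw [algebraicIndependent_iff]
  intro p hp
  by_contra hp0
  have h1 : MvPolynomial.aeval (fun i => Ideal.Quotient.mk q (y i)) p
      = Ideal.Quotient.mk q (MvPolynomial.aeval y p) := by
    have := MvPolynomial.map_aeval (R := k) y (Ideal.Quotient.mk q) p
    rw [this, MvPolynomial.aeval_def]
    rfl
  rw [h1, Ideal.Quotient.eq_zero_iff_mem] at hp
  exact Set.disjoint_left.1 hdisj hp ⟨p, mem_nonZeroDivisors_of_ne_zero hp0, rfl⟩

/-- The Krull dimension of a nonzero finitely generated algebra over a field, computed by
Noether normalization, is the number of variables. -/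
theorem exists_isIntegral_mvPolynomial_ringKrullDim_eq (k R : Type*) [Field k] [CommRing R]
    [Nontrivial R] [Algebra k R] [Algebra.FiniteType k R] :
    ∃ (s : ℕ) (g : MvPolynomial (Fin s) k →ₐ[k] R), Function.Injective g ∧ g.IsIntegral ∧
      ringKrullDim R = s := by
  obtain ⟨s, g, hg, hi⟩ := exists_integral_inj_algHom_of_fg k R
  refine ⟨s, g, hg, hi, ?_⟩
  algebraize [g.toRingHom]
  have : Algebra.IsIntegral (MvPolynomial (Fin s) k) R := ⟨hi⟩
  rw [ringKrullDim_eq_of_isIntegral_of_injective (R := MvPolynomial (Fin s) k) (S := R) hg]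
  simp

/-- Modulo a prime that preserves the independence of `y`, the ring is a domain, integral over the
images of the `s` Noether variables. Its transcendence degree is then at most `s` and at least `d`.
-/
theorem AlgebraicIndependent.card_le_ringKrullDim {k R : Type*} [Field k] [CommRing R]
    [Algebra k R] [Algebra.FiniteType k R] {d : ℕ} {y : Fin d → R}
    (hy : AlgebraicIndependent k y) : (d : WithBot ℕ∞) ≤ ringKrullDim R := by
  have : Nontrivial R := hy.algebraMap_injective.nontrivial
  obtain ⟨s, g, hg, hi, hs⟩ := exists_isIntegral_mvPolynomial_ringKrullDim_eq k R
  rw [hs]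
  obtain ⟨q, hq, hyq⟩ := hy.exists_isPrime_quotient
  let g' : MvPolynomial (Fin s) k →ₐ[k] R ⧸ q := (Ideal.Quotient.mkₐ k q).comp g
  let t : Set (R ⧸ q) := range fun i => g' (MvPolynomial.X i)
  have hmem : ∀ p, g' p ∈ Algebra.adjoin k t := by
    intro p
    have : g' p = MvPolynomial.aeval (fun i => g' (MvPolynomial.X i)) p := by
      conv_lhs => rw [MvPolynomial.aeval_unique g']
      rfl
    rw [this, Algebra.adjoin_range_eq_range_aeval]
    exact ⟨p, rfl⟩
  have : Algebra.IsIntegral (Algebra.adjoin k t) (R ⧸ q) := by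
    refine ⟨fun x => ?_⟩
    obtain ⟨x, rfl⟩ := Ideal.Quotient.mk_surjective x
    obtain ⟨p, hpm, hp⟩ := hi x
    let h : MvPolynomial (Fin s) k →+* Algebra.adjoin k t := (g'.codRestrict _ hmem).toRingHom
    refine ⟨p.map h, hpm.map h, ?_⟩
    rw [Polynomial.eval₂_map]
    have hc : (algebraMap (Algebra.adjoin k t) (R ⧸ q)).comp h
        = (Ideal.Quotient.mk q).comp g.toRingHom := rfl
    rw [hc, ← Polynomial.hom_eval₂, hp, map_zero]
  have h1 := Algebra.IsAlgebraic.trdeg_le_cardinalMk k t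
  have h2 := hyq.lift_cardinalMk_le_trdeg
  have h3 : Cardinal.mk t ≤ s := by
    have := Cardinal.mk_range_le_lift (f := fun i => g' (MvPolynomial.X i))
    simpa using this
  have h4 := h2.trans (Cardinal.lift_le.2 (h1.trans h3))
  have : d ≤ s := by simpa using h4
  exact_mod_cast this

/-- The Noether variables stay independent modulo some prime. In that quotient domain the given
generators contain a transcendence basis, and independence lifts back to `R`. This is what allows
dimension to be tested on coordinates alone. -/
theorem exists_algebraicIndependent_of_le_ringKrullDim {k R ι : Type*} [Field k] [CommRing R]
    [Algebra k R] [Finite ι] (x : ι → R) (hx : Algebra.adjoin k (range x) = ⊤)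
    {d : ℕ} (hd : (d : WithBot ℕ∞) ≤ ringKrullDim R) :
    ∃ f : Fin d → ι, AlgebraicIndependent k (x ∘ f) := by
  have : Nontrivial R := by
    by_contra h
    rw [not_nontrivial_iff_subsingleton] at h
    rw [ringKrullDim_eq_bot_of_subsingleton] at hd
    exact absurd hd (by simp)
  have : Algebra.FiniteType k R := ⟨by
    rw [← hx]; exact ⟨(finite_range x).toFinset, by simp⟩⟩
  obtain ⟨s, g, hg, hi, hs⟩ := exists_isIntegral_mvPolynomial_ringKrullDim_eq k R
  rw [hs] at hd
  have hds : d ≤ s := by exact_mod_cast hd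
  have hy : AlgebraicIndependent k fun i => g (MvPolynomial.X i) :=
    (MvPolynomial.algebraicIndependent_X (Fin s) k).map' hg
  obtain ⟨q, hq, hyq⟩ := hy.exists_isPrime_quotient
  let xb : ι → R ⧸ q := fun i => Ideal.Quotient.mkₐ k q (x i)
  have hxb : Algebra.adjoin k (range xb) = ⊤ := by
    have : range xb = Ideal.Quotient.mkₐ k q '' range x := by
      rw [← range_comp]; rfl
    rw [this, ← AlgHom.map_adjoin, hx, Algebra.map_top]
    exact (AlgHom.range_eq_top _).2 (Ideal.Quotient.mkₐ_surjective k q)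
  have : Algebra.IsAlgebraic (Algebra.adjoin k (range xb)) (R ⧸ q) :=
    ⟨fun a => isAlgebraic_algebraMap
      (⟨a, hxb ▸ Algebra.mem_top⟩ : Algebra.adjoin k (range xb))⟩
  obtain ⟨t, ht, htb⟩ := exists_isTranscendenceBasis_subset (R := k) (range xb)
  have hts : (s : Cardinal) ≤ Cardinal.mk t := by
    rw [htb.cardinalMk_eq_trdeg]
    simpa using hyq.lift_cardinalMk_le_trdeg
  have htf : Finite t := ((finite_range xb).subset ht)
  have hn : d ≤ Nat.card t := by
    rw [← Nat.cast_card] at hts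
    exact hds.trans (by exact_mod_cast hts)
  choose σ hσ using fun a : t => ht a.2
  let e := (Finite.equivFin t).symm
  refine ⟨fun i => σ (e (Fin.castLE hn i)), ?_⟩
  have h1 : AlgebraicIndependent k (fun i : Fin d => ((e (Fin.castLE hn i) : t) : R ⧸ q)) :=
    htb.1.comp _ (e.injective.comp (Fin.castLE_injective hn))
  refine AlgebraicIndependent.of_comp (Ideal.Quotient.mkₐ k q) ?_
  have h2 : (Ideal.Quotient.mkₐ k q ∘ x ∘ fun i => σ (e (Fin.castLE hn i)))
      = fun i : Fin d => ((e (Fin.castLE hn i) : t) : R ⧸ q) := funext fun i => hσ _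
  rw [h2]
  exact h1

/-! ### Zariski density and dimension by coordinate projections -/

open MvPolynomial in
/-- A set of points of affine space on which no nonzero polynomial vanishes. -/
def ZariskiDense {κ : Type*} (T : Set (κ → ℝ)) : Prop :=
  ∀ p : MvPolynomial κ ℝ, (∀ x ∈ T, eval x p = 0) → p = 0

/-- Some projection of `A` to `d` coordinates is Zariski dense. -/
def HasCoordDim {ι : Type*} (d : ℕ) (A : Set (ι → ℝ)) : Prop :=
  ∃ f : Fin d → ι, ZariskiDense ((fun a : ι → ℝ => a ∘ f) '' A)

namespace ZariskiDense

open MvPolynomial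

variable {κ ι : Type*}

theorem mono {S T : Set (κ → ℝ)} (hS : ZariskiDense S) (h : S ⊆ T) : ZariskiDense T :=
  fun p hp => hS p fun x hx => hp x (h hx)

theorem nonempty {S : Set (κ → ℝ)} (hS : ZariskiDense S) : S.Nonempty := by
  by_contra h
  rw [not_nonempty_iff_eq_empty] at h
  exact one_ne_zero (hS 1 (by simp [h]))

/-- Irreducibility of affine space: if each piece were killed by a nonzero polynomial, the product
of these would kill `S`. -/
theorem exists_of_subset_iUnion {α : Type*} [Finite α] {S : Set (κ → ℝ)} (hS : ZariskiDense S)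
    {T : α → Set (κ → ℝ)} (hT : S ⊆ ⋃ i, T i) : ∃ i, ZariskiDense (T i) := by
  cases nonempty_fintype α
  by_contra! h
  unfold ZariskiDense at h
  push Not at h
  choose p hp hp0 using h
  refine Finset.prod_ne_zero_iff.2 (fun i _ => hp0 i) (hS (∏ i, p i) fun x hx => ?_)
  obtain ⟨i, hi⟩ := mem_iUnion.1 (hT hx)
  rw [map_prod]
  exact Finset.prod_eq_zero (Finset.mem_univ i) (hp i x hi)

theorem image_comp {κ' : Type*} {S : Set (κ → ℝ)} (hS : ZariskiDense S) {g : κ' → κ}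
    (hg : Function.Injective g) : ZariskiDense ((fun a : κ → ℝ => a ∘ g) '' S) := by
  intro p hp
  apply rename_injective g hg
  rw [map_zero]
  refine hS _ fun x hx => ?_
  rw [eval_rename]
  exact hp _ ⟨x, hx, rfl⟩

theorem of_interior_nonempty [Finite κ] {S : Set (κ → ℝ)} (hS : (interior S).Nonempty) :
    ZariskiDense S := by
  cases nonempty_fintype κ
  obtain ⟨x, hx⟩ := hS
  obtain ⟨ε, hε, hb⟩ := Metric.isOpen_iff.1 isOpen_interior x hx
  intro p hp
  refine MvPolynomial.funext_set (fun i => Metric.ball (x i) ε) (fun i => ?_) fun y hy => ?_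
  · exact infinite_of_mem_nhds (x i) (Metric.ball_mem_nhds _ hε)
  · rw [map_zero]
    refine hp y (interior_subset (hb ?_))
    rw [ball_pi _ hε]
    exact hy

/-- A set over a Zariski dense set of parameters, with Zariski dense fibers, is Zariski dense. -/
theorem of_fibers {τ : Type*} {M : Set (κ ⊕ τ → ℝ)} {B : Set (τ → ℝ)} (hB : ZariskiDense B)
    (hM : ∀ t ∈ B, ZariskiDense {y : κ → ℝ | Sum.elim y t ∈ M}) : ZariskiDense M := by
  intro p hp
  -- View `p` as a polynomial in the `κ`-variables with coefficients in the `τ`-variables. Density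
  -- of the fibers makes each coefficient vanish on `B`, and density of `B` makes it zero.
  have heval : ∀ (y : κ → ℝ) (t : τ → ℝ), eval y (map (eval t) (sumRingEquiv ℝ κ τ p))
      = eval (Sum.elim y t) p := by
    intro y t
    have : ((eval y).comp (map (eval t))).comp (sumRingEquiv ℝ κ τ : MvPolynomial (κ ⊕ τ) ℝ →+* _)
        = eval (Sum.elim y t) := by
      refine ringHom_ext (fun r => ?_) fun i => ?_
      · simp [sumRingEquiv_C]
      · rcases i with i | i
        · simp [sumRingEquiv_X_inl]
        · simp [sumRingEquiv_X_inr]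
    exact congrArg (fun h => h p) this
  apply (sumRingEquiv ℝ κ τ).injective
  rw [map_zero]
  ext1 m
  rw [coeff_zero]
  refine hB _ fun t ht => ?_
  have h0 : map (eval t) (sumRingEquiv ℝ κ τ p) = 0 :=
    hM t ht _ fun y hy => (heval y t).trans (hp _ hy)
  rw [← coeff_map, h0, coeff_zero]

theorem image_comp_iff {f : κ → ι} {A : Set (ι → ℝ)} :
    ZariskiDense ((fun a : ι → ℝ => a ∘ f) '' A) ↔
      ∀ p, rename f p ∈ vanishingIdeal ℝ A → p = 0 := by
  simp only [ZariskiDense, mem_vanishingIdeal_iff, forall_mem_image, aeval_rename]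
  rfl

theorem image_comp_iff_algebraicIndependent {f : κ → ι} {A : Set (ι → ℝ)} :
    ZariskiDense ((fun a : ι → ℝ => a ∘ f) '' A) ↔ AlgebraicIndependent ℝ
      fun i => Ideal.Quotient.mkₐ ℝ (vanishingIdeal ℝ A) (X (f i)) := by
  rw [image_comp_iff, algebraicIndependent_iff]
  refine forall_congr' fun p => ?_
  have : aeval (fun i => Ideal.Quotient.mkₐ ℝ (vanishingIdeal ℝ A) (X (f i))) p
      = Ideal.Quotient.mkₐ ℝ (vanishingIdeal ℝ A) (rename f p) := by
    rw [← AlgHom.comp_apply]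
    congr 1
    ext i
    simp
  rw [this, Ideal.Quotient.mkₐ_eq_mk, Ideal.Quotient.eq_zero_iff_mem]

theorem injective_of_image_comp {f : κ → ι} {A : Set (ι → ℝ)}
    (h : ZariskiDense ((fun a : ι → ℝ => a ∘ f) '' A)) : Function.Injective f := by
  intro i j hij
  by_contra hne
  have := h (X i - X j) (by rintro _ ⟨a, -, rfl⟩; simp [hij])
  exact hne (X_injective (sub_eq_zero.1 this))

end ZariskiDense

namespace HasCoordDim

variable {ι : Type*}

theorem of_card_le {κ : Type*} [Finite κ] {d : ℕ} {A : Set (ι → ℝ)} (hd : d ≤ Nat.card κ)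
    {f : κ → ι} (h : ZariskiDense ((fun a : ι → ℝ => a ∘ f) '' A)) : HasCoordDim d A := by
  let g : Fin d → κ := fun i => (Finite.equivFin κ).symm (Fin.castLE hd i)
  refine ⟨f ∘ g, ?_⟩
  have := h.image_comp (g := g)
    ((Finite.equivFin κ).symm.injective.comp (Fin.castLE_injective hd))
  rwa [image_image] at this

theorem of_le {d d' : ℕ} {A : Set (ι → ℝ)} (h : HasCoordDim d' A) (hd : d ≤ d') :
    HasCoordDim d A := by
  obtain ⟨f, hf⟩ := h
  exact of_card_le (by simpa using hd) hf

theorem mono {d : ℕ} {A B : Set (ι → ℝ)} (h : HasCoordDim d A) (hAB : A ⊆ B) :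
    HasCoordDim d B := by
  obtain ⟨f, hf⟩ := h
  exact ⟨f, hf.mono (image_mono hAB)⟩

theorem of_image_comp {κ : Type*} {d : ℕ} {A : Set (ι → ℝ)} {g : κ → ι}
    (h : HasCoordDim d ((fun a : ι → ℝ => a ∘ g) '' A)) : HasCoordDim d A := by
  obtain ⟨f, hf⟩ := h
  refine ⟨g ∘ f, ?_⟩
  rwa [image_image] at hf

theorem le_card [Finite ι] {d : ℕ} {A : Set (ι → ℝ)} (h : HasCoordDim d A) :
    d ≤ Nat.card ι := by
  obtain ⟨f, hf⟩ := h
  simpa using Nat.card_le_card_of_injective f hf.injective_of_image_comp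

/-- The dimension of a product is at most the sum of the dimensions. -/
theorem of_prod {κ : Type*} {d a b : ℕ} {M : Set (ι ⊕ κ → ℝ)}
    (h : HasCoordDim d M)
    (ha : ¬ HasCoordDim (a + 1) ((fun v : ι ⊕ κ → ℝ => v ∘ Sum.inl) '' M))
    (hb : ¬ HasCoordDim (b + 1) ((fun v : ι ⊕ κ → ℝ => v ∘ Sum.inr) '' M)) :
    d ≤ a + b := by
  obtain ⟨f, hf⟩ := h
  let L := {i : Fin d // (f i).isLeft}
  let R := {i : Fin d // ¬ (f i).isLeft}
  have hL : ∀ i : L, ∃ j, f i = Sum.inl j := fun i => Sum.isLeft_iff.1 i.2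
  have hR : ∀ i : R, ∃ j, f i = Sum.inr j := fun i => by
    rcases h : f i with j | j
    · exact absurd i.2 (by simp [h])
    · exact ⟨j, rfl⟩
  choose l hl using hL
  choose r hr using hR
  have hLd : Nat.card L ≤ a := by
    by_contra! hlt
    refine ha (of_card_le (κ := L) (f := l) hlt ?_)
    have := hf.image_comp (g := ((↑) : L → Fin d)) Subtype.val_injective
    have he : (fun v : ι ⊕ κ → ℝ => (v ∘ Sum.inl) ∘ l) = fun v => (v ∘ f) ∘ ((↑) : L → Fin d) :=
      funext fun v => funext fun i => congrArg v (hl i).symm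
    rw [image_image] at this ⊢
    rwa [he]
  have hRd : Nat.card R ≤ b := by
    by_contra! hlt
    refine hb (of_card_le (κ := R) (f := r) hlt ?_)
    have := hf.image_comp (g := ((↑) : R → Fin d)) Subtype.val_injective
    have he : (fun v : ι ⊕ κ → ℝ => (v ∘ Sum.inr) ∘ r) = fun v => (v ∘ f) ∘ ((↑) : R → Fin d) :=
      funext fun v => funext fun i => congrArg v (hr i).symm
    rw [image_image] at this ⊢
    rwa [he]
  have hcard : Nat.card L + Nat.card R = d := by
    rw [← Nat.card_sum, Nat.card_congr (Equiv.sumCompl fun i : Fin d => ((f i).isLeft : Prop))]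
    simp
  omega

/-- If the fibers of `M` over a Zariski dense set of parameters have dimension at least `k`, then
the dimension of `M` is at least `k` plus the number of parameters. -/
theorem of_fibers {τ : Type*} [Finite ι] [Finite τ] {k : ℕ} {M : Set (ι ⊕ τ → ℝ)}
    (hB : ZariskiDense {t : τ → ℝ | HasCoordDim k {y : ι → ℝ | Sum.elim y t ∈ M}}) :
    HasCoordDim (k + Nat.card τ) M := by
  -- The coordinates that witness the dimension of a fiber may vary with `t`, but there are finitely
  -- many choices, so one choice works for a Zariski dense set of `t`.
  obtain ⟨f, hf⟩ := hB.exists_of_subset_iUnion (α := Fin k → ι)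
    (T := fun f => {t : τ → ℝ | ZariskiDense
      ((fun a : ι → ℝ => a ∘ f) '' {y : ι → ℝ | Sum.elim y t ∈ M})})
    (fun t ⟨f, hf⟩ => mem_iUnion.2 ⟨f, hf⟩)
  refine of_card_le (κ := Fin k ⊕ τ) (f := Sum.map f id) (by simp) ?_
  refine ZariskiDense.of_fibers hf fun t ht => ht.mono ?_
  rintro _ ⟨y, hy, rfl⟩
  refine ⟨Sum.elim y t, hy, ?_⟩
  funext i
  rcases i with i | i <;> rfl

end HasCoordDim

/-! ### The Krull dimension of the ring of polynomial functions in coordinates -/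

section Coordinates

variable {E ι : Type*} [AddCommGroup E] [Module ℝ E] (φ : E ≃ₗ[ℝ] (ι → ℝ))

theorem polyFunctionsOn_eq_adjoin_coord [Finite ι] (A : Set E) :
    polyFunctionsOn A = Algebra.adjoin ℝ (range fun (i : ι) (a : A) => φ a i) := by
  cases nonempty_fintype ι
  classical
  apply le_antisymm
  · refine Algebra.adjoin_le ?_
    rintro _ ⟨l, rfl⟩
    have : (fun a : A => l a)
        = ∑ i, l (φ.symm (Pi.single i 1)) • fun a : A => φ a i := by
      funext a
      have h1 : (a : E) = ∑ i, φ a i • φ.symm (Pi.single i 1) := by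
        apply φ.injective
        simp only [map_sum, map_smul, LinearEquiv.apply_symm_apply]
        exact pi_eq_sum_univ' _
      conv_lhs => rw [h1]
      simp [mul_comm]
    simp only [this]
    exact Subalgebra.sum_mem _ fun i _ =>
      Subalgebra.smul_mem _ (Algebra.subset_adjoin (mem_range_self i)) _
  · refine Algebra.adjoin_le ?_
    rintro _ ⟨i, rfl⟩
    exact Algebra.subset_adjoin ⟨(LinearMap.proj i).comp φ.toLinearMap, rfl⟩

theorem zariskiDense_image_iff_algebraicIndependent {κ : Type*} (f : κ → ι) (A : Set E) :
    ZariskiDense ((fun a : ι → ℝ => a ∘ f) '' (φ '' A)) ↔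
      AlgebraicIndependent ℝ fun i (a : A) => φ a (f i) := by
  rw [algebraicIndependent_iff]
  refine forall_congr' fun p => imp_congr_left ?_
  rw [funext_iff]
  simp only [forall_mem_image, Subtype.forall, Pi.zero_apply]
  refine forall₂_congr fun a ha => ?_
  have := MvPolynomial.map_aeval (R := ℝ) (fun i (a : A) => φ a (f i))
    (Pi.evalRingHom (fun _ : A => ℝ) ⟨a, ha⟩) p
  simp only [Pi.evalRingHom_apply] at this
  rw [this]
  rfl

/-- The coordinate functions generate the ring of polynomial functions, and a choice of them is
algebraically independent exactly when the corresponding projection of `A` is Zariski dense. -/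
theorem natCast_le_semialgDim_iff [Finite ι] (A : Set E) (d : ℕ) :
    (d : WithBot ℕ∞) ≤ semialgDim A ↔ HasCoordDim d (φ '' A) := by
  let x : ι → A → ℝ := fun i a => φ a i
  have hA : semialgDim A = ringKrullDim (Algebra.adjoin ℝ (range x)) := by
    rw [semialgDim, polyFunctionsOn_eq_adjoin_coord φ]
  let y : ι → Algebra.adjoin ℝ (range x) := fun i => ⟨x i, Algebra.subset_adjoin ⟨i, rfl⟩⟩
  have hy : Algebra.adjoin ℝ (range y) = ⊤ := by
    rw [← Algebra.adjoin_adjoin_coe_preimage]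
    congr 1
    ext z
    simp only [mem_range, mem_preimage, y, Subtype.ext_iff]
  have hv : ∀ f : Fin d → ι, AlgebraicIndependent ℝ (y ∘ f) ↔
      ZariskiDense ((fun a : ι → ℝ => a ∘ f) '' (φ '' A)) := fun f => by
    rw [zariskiDense_image_iff_algebraicIndependent]
    exact ⟨fun h => h.map' (f := Subalgebra.val _) Subtype.val_injective,
      fun h => AlgebraicIndependent.of_comp (Subalgebra.val _) h⟩
  have : Algebra.FiniteType ℝ (Algebra.adjoin ℝ (range x)) :=
    ⟨by rw [← hy]; exact ⟨(finite_range y).toFinset, by simp⟩⟩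
  rw [hA]
  constructor
  · intro h
    obtain ⟨f, hf⟩ := exists_algebraicIndependent_of_le_ringKrullDim y hy h
    exact ⟨f, (hv f).1 hf⟩
  · rintro ⟨f, hf⟩
    exact ((hv f).2 hf).card_le_ringKrullDim

theorem semialgDim_empty : semialgDim (∅ : Set E) = ⊥ := by
  have : Subsingleton (polyFunctionsOn (∅ : Set E)) :=
    ⟨fun f g => Subtype.ext (funext fun a => a.2.elim)⟩
  exact ringKrullDim_eq_bot_of_subsingleton

theorem exists_semialgDim_eq_natCast [Finite ι] {A : Set E} (hA : A.Nonempty) :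
    ∃ d : ℕ, semialgDim A = d ∧ HasCoordDim d (φ '' A) ∧ ¬ HasCoordDim (d + 1) (φ '' A) := by
  classical
  have h0 : HasCoordDim 0 (φ '' A) := by
    refine ⟨Fin.elim0, fun p hp => ?_⟩
    obtain ⟨a, ha⟩ := hA
    have := hp _ ⟨_, ⟨a, ha, rfl⟩, rfl⟩
    rw [MvPolynomial.eq_C_of_isEmpty p] at this ⊢
    simpa using this
  have hb : ∀ d, HasCoordDim d (φ '' A) → d ≤ Nat.card ι := fun d hd => hd.le_card
  let d := Nat.findGreatest (fun d => HasCoordDim d (φ '' A)) (Nat.card ι)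
  have hd : HasCoordDim d (φ '' A) :=
    Nat.findGreatest_spec (P := fun d => HasCoordDim d (φ '' A)) (Nat.zero_le _) h0
  have hd1 : ¬ HasCoordDim (d + 1) (φ '' A) := fun h =>
    absurd (Nat.le_findGreatest (P := fun d => HasCoordDim d (φ '' A)) (hb _ h) h)
      (Nat.not_succ_le_self d)
  refine ⟨d, le_antisymm ?_ ((natCast_le_semialgDim_iff φ A d).2 hd), hd, hd1⟩
  by_contra hlt
  rw [not_le] at hlt
  refine hd1 ((natCast_le_semialgDim_iff φ A (d + 1)).1 ?_)
  have := ENat.WithBot.add_one_le_iff.2 hlt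
  exact_mod_cast this

end Coordinates

/-! ### Locally algebraic sets and their projections -/

/-- The intersection of an algebraic set with an open set. -/
def IsLocallyAlgebraic {ι : Type*} (A : Set (ι → ℝ)) : Prop :=
  ∃ (s : Set (MvPolynomial ι ℝ)) (O : Set (ι → ℝ)), IsOpen O ∧
    A = O ∩ {x | ∀ p ∈ s, MvPolynomial.eval x p = 0}

namespace IsLocallyAlgebraic

open MvPolynomial

variable {ι κ : Type*}

theorem inter {A B : Set (ι → ℝ)} (hA : IsLocallyAlgebraic A) (hB : IsLocallyAlgebraic B) :
    IsLocallyAlgebraic (A ∩ B) := by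
  obtain ⟨s, O, hO, rfl⟩ := hA
  obtain ⟨t, Q, hQ, rfl⟩ := hB
  refine ⟨s ∪ t, O ∩ Q, hO.inter hQ, ?_⟩
  ext x
  simp only [mem_inter_iff, mem_ofPred_eq, mem_union]
  grind

theorem of_isOpen {O : Set (ι → ℝ)} (hO : IsOpen O) : IsLocallyAlgebraic O :=
  ⟨∅, O, hO, by simp⟩

theorem zeros (p : MvPolynomial ι ℝ) : IsLocallyAlgebraic {x | eval x p = 0} :=
  ⟨{p}, univ, isOpen_univ, by simp⟩

theorem preimage_comp {A : Set (ι → ℝ)} (hA : IsLocallyAlgebraic A) (g : ι → κ) :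
    IsLocallyAlgebraic {x : κ → ℝ | x ∘ g ∈ A} := by
  obtain ⟨s, O, hO, rfl⟩ := hA
  refine ⟨rename g '' s, {x | x ∘ g ∈ O}, hO.preimage (by fun_prop), ?_⟩
  ext x
  simp [eval_rename]

/-- A locally algebraic set is open in its Zariski closure. -/
theorem exists_isOpen_eq {A : Set (ι → ℝ)} (hA : IsLocallyAlgebraic A) :
    ∃ O : Set (ι → ℝ), IsOpen O ∧ A = O ∩ {x | ∀ p ∈ vanishingIdeal ℝ A, eval x p = 0} := by
  obtain ⟨s, O, hO, h⟩ := hA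
  refine ⟨O, hO, subset_antisymm ?_ ?_⟩
  · exact fun x hx => ⟨(h ▸ hx : x ∈ O ∩ _).1, fun p hp => hp x hx⟩
  · intro x hx
    rw [h]
    refine ⟨hx.1, fun p hp => hx.2 p fun y hy => ?_⟩
    rw [h] at hy
    exact hy.2 p hp

/-- A locally algebraic set with Zariski dense projection contains an irreducible one with
Zariski dense projection. -/
theorem exists_isPrime_vanishingIdeal [Finite ι] {A : Set (ι → ℝ)} (hA : IsLocallyAlgebraic A)
    {f : κ → ι} (hf : ZariskiDense ((fun a : ι → ℝ => a ∘ f) '' A)) :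
    ∃ A' ⊆ A, IsLocallyAlgebraic A' ∧ (vanishingIdeal ℝ A').IsPrime ∧
      ZariskiDense ((fun a : ι → ℝ => a ∘ f) '' A') := by
  -- By noetherianity there is a candidate with maximal vanishing ideal. If `g * h` vanishes on it,
  -- one of the pieces `g = 0` and `g ≠ 0` still has dense projection, and maximality forces `g`,
  -- respectively `h`, to vanish on the whole candidate.
  let T : Set (Ideal (MvPolynomial ι ℝ)) := {J | ∃ A' ⊆ A, IsLocallyAlgebraic A' ∧
    ZariskiDense ((fun a : ι → ℝ => a ∘ f) '' A') ∧ J = vanishingIdeal ℝ A'}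
  obtain ⟨J, ⟨A', hA'A, hA', hfA', rfl⟩, hmax⟩ :=
    (wellFounded_gt (α := Ideal (MvPolynomial ι ℝ))).has_min T
      ⟨_, A, subset_rfl, hA, hf, rfl⟩
  have hmax' : ∀ B ⊆ A', IsLocallyAlgebraic B → ZariskiDense ((fun a : ι → ℝ => a ∘ f) '' B) →
      ∀ p ∈ vanishingIdeal ℝ B, p ∈ vanishingIdeal ℝ A' := by
    intro B hBA hB hfB
    have h1 : vanishingIdeal ℝ A' ≤ vanishingIdeal ℝ B := vanishingIdeal_anti_mono hBA
    have h2 := hmax _ ⟨B, hBA.trans hA'A, hB, hfB, rfl⟩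
    exact (eq_of_le_of_not_lt h1 h2).ge
  refine ⟨A', hA'A, hA', ⟨?_, ?_⟩, hfA'⟩
  · rw [Ideal.ne_top_iff_one]
    intro h1
    obtain ⟨_, a, ha, -⟩ := hfA'.nonempty
    exact one_ne_zero ((map_one _).symm.trans (h1 a ha))
  · intro g h hgh
    by_contra! hnot
    have hsplit : (fun a : ι → ℝ => a ∘ f) '' A' ⊆
        ⋃ b : Bool, (fun a : ι → ℝ => a ∘ f) ''
          (A' ∩ if b then {x | eval x g = 0} else {x | eval x g ≠ 0}) := by
      rintro _ ⟨a, ha, rfl⟩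
      by_cases hg : eval a g = 0
      · exact mem_iUnion.2 ⟨true, a, ⟨ha, by simpa using hg⟩, rfl⟩
      · exact mem_iUnion.2 ⟨false, a, ⟨ha, by simpa using hg⟩, rfl⟩
    obtain ⟨b, hb⟩ := hfA'.exists_of_subset_iUnion hsplit
    cases b
    · simp only [Bool.false_eq_true, if_false] at hb
      refine hnot.2 (hmax' _ inter_subset_left (hA'.inter (of_isOpen ?_)) hb h ?_)
      · exact isOpen_ne_fun (continuous_eval g) continuous_const
      · intro x hx
        have := hgh x hx.1
        rw [map_mul] at this
        exact (mul_eq_zero.1 this).resolve_left hx.2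
    · simp only [if_true] at hb
      exact hnot.1 (hmax' _ inter_subset_left (hA'.inter (zeros g)) hb g fun x hx => hx.2)

end IsLocallyAlgebraic

/-! ### Projection of irreducible locally algebraic sets -/

/-- Pseudo-division by an element of an ideal of minimal degree. -/
theorem Polynomial.exists_pseudoDiv {R : Type*} [CommRing R] (q : Ideal (Polynomial R))
    {F : Polynomial R} (hF : F ∈ q)
    (hmin : ∀ G ∈ q, Polynomial.C G.leadingCoeff ∉ q → F.natDegree ≤ G.natDegree)
    (G : Polynomial R) (hG : G ∈ q) :
    ∃ (N : ℕ) (H : Polynomial R), ∀ i,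
      Polynomial.C ((Polynomial.C (F.leadingCoeff ^ N) * G - H * F).coeff i) ∈ q := by
  induction hd : G.degree using WellFoundedLT.induction generalizing G with
  | ind d ih =>
    subst hd
    by_cases hG0 : G = 0
    · exact ⟨0, 0, fun i => by simp [hG0]⟩
    -- A leading term with coefficient in `q` can be dropped, as it only contributes coefficients in
    -- `q`. Otherwise `hmin` makes `G` long enough to be reduced by `F`.
    by_cases hlc : Polynomial.C G.leadingCoeff ∈ q
    · have hmon : Polynomial.monomial G.natDegree G.leadingCoeff ∈ q := by
        rw [← Polynomial.C_mul_X_pow_eq_monomial]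
        exact q.mul_mem_right _ hlc
      have hE : G.eraseLead ∈ q := by
        rw [← Polynomial.self_sub_monomial_natDegree_leadingCoeff]
        exact q.sub_mem hG hmon
      obtain ⟨N, H, hNH⟩ := ih _ (Polynomial.degree_eraseLead_lt hG0) _ hE rfl
      refine ⟨N, H, fun i => ?_⟩
      have h1 : Polynomial.C (F.leadingCoeff ^ N) * G - H * F
          = (Polynomial.C (F.leadingCoeff ^ N) * G.eraseLead - H * F)
            + Polynomial.C (F.leadingCoeff ^ N) *
              Polynomial.monomial G.natDegree G.leadingCoeff := by
        conv_lhs => rw [← G.eraseLead_add_monomial_natDegree_leadingCoeff]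
        ring
      rw [h1, Polynomial.coeff_add, Polynomial.C_add]
      refine q.add_mem (hNH i) ?_
      rw [Polynomial.coeff_C_mul, Polynomial.C_mul, Polynomial.coeff_monomial]
      refine q.mul_mem_left _ ?_
      split_ifs
      · exact hlc
      · simp
    · have hle := hmin G hG hlc
      let G' := Polynomial.C F.leadingCoeff * G
        - Polynomial.C G.leadingCoeff * Polynomial.X ^ (G.natDegree - F.natDegree) * F
      have hG' : G' ∈ q := q.sub_mem (q.mul_mem_left _ hG) (q.mul_mem_left _ hF)
      have hdeg : G'.degree < G.degree := by
        rw [Polynomial.degree_eq_natDegree hG0, Polynomial.degree_lt_iff_coeff_zero]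
        intro m hm
        simp only [G', Polynomial.coeff_sub, Polynomial.coeff_C_mul, mul_assoc]
        rw [Polynomial.coeff_X_pow_mul', if_pos (by omega)]
        rcases hm.eq_or_lt with rfl | hlt
        · rw [Nat.sub_sub_self hle]
          simp only [Polynomial.coeff_natDegree]
          ring
        · rw [Polynomial.coeff_eq_zero_of_natDegree_lt hlt,
            Polynomial.coeff_eq_zero_of_natDegree_lt (p := F) (by omega)]
          ring
      obtain ⟨N, H, hNH⟩ := ih _ hdeg _ hG' rfl
      refine ⟨N + 1, H + Polynomial.C (F.leadingCoeff ^ N) *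
        (Polynomial.C G.leadingCoeff * Polynomial.X ^ (G.natDegree - F.natDegree)), fun i => ?_⟩
      convert hNH i using 3
      simp only [G', pow_succ, Polynomial.C_mul]
      ring

/-- A simple zero of a function of one real variable persists under perturbation. -/
theorem eventually_exists_zero_of_hasDerivAt {X : Type*} [TopologicalSpace X] {f : X × ℝ → ℝ}
    (hf : Continuous f) {u₀ : X} {θ₀ c : ℝ} (hd : HasDerivAt (fun θ => f (u₀, θ)) c θ₀)
    (h0 : f (u₀, θ₀) = 0) (hc : c ≠ 0) {O : Set (X × ℝ)} (hO : IsOpen O) (hO₀ : (u₀, θ₀) ∈ O) :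
    ∀ᶠ u in 𝓝 u₀, ∃ θ, (u, θ) ∈ O ∧ f (u, θ) = 0 := by
  wlog hpos : 0 < c generalizing f c
  · have := this (f := fun x => - f x) (by fun_prop) hd.neg (by simp [h0]) (neg_ne_zero.2 hc)
      (by rcases lt_or_gt_of_ne hc with h | h <;> [linarith; exact absurd h hpos])
    simpa using this
  have hslope := (hasDerivAt_iff_tendsto_slope.1 hd).eventually (lt_mem_nhds hpos)
  have hOθ : ∀ᶠ θ in 𝓝 θ₀, (u₀, θ) ∈ O :=
    (hO.preimage (by fun_prop : Continuous fun θ : ℝ => (u₀, θ))).mem_nhds hO₀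
  obtain ⟨ε, hε, hball⟩ := Metric.eventually_nhds_iff_ball.1
    ((eventually_nhdsWithin_iff.1 hslope).and hOθ)
  have hin : ∀ θ ∈ Icc (θ₀ - ε / 2) (θ₀ + ε / 2), θ ∈ Metric.ball θ₀ ε := by
    intro θ hθ
    rw [Metric.mem_ball, Real.dist_eq, abs_lt]
    constructor <;> linarith [hθ.1, hθ.2]
  have h1 : f (u₀, θ₀ - ε / 2) < 0 := by
    have := (hball _ (hin (θ₀ - ε / 2) ⟨le_rfl, by linarith⟩)).1
      (by simp [hε.ne'])
    rw [slope_def_field, h0, sub_zero] at this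
    have h2 : θ₀ - ε / 2 - θ₀ < 0 := by linarith
    by_contra! h3
    exact absurd (div_nonpos_of_nonneg_of_nonpos h3 h2.le) (not_le.2 this)
  have h2 : 0 < f (u₀, θ₀ + ε / 2) := by
    have := (hball _ (hin (θ₀ + ε / 2) ⟨by linarith, le_rfl⟩)).1
      (by simp [hε.ne'])
    rw [slope_def_field, h0, sub_zero] at this
    have h2 : 0 < θ₀ + ε / 2 - θ₀ := by linarith
    by_contra! h3
    exact absurd (div_nonpos_of_nonpos_of_nonneg h3 h2.le) (not_le.2 this)
  have e1 : ∀ᶠ u in 𝓝 u₀, f (u, θ₀ - ε / 2) < 0 :=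
    (by fun_prop : Continuous fun u => f (u, θ₀ - ε / 2)).continuousAt.eventually (gt_mem_nhds h1)
  have e2 : ∀ᶠ u in 𝓝 u₀, 0 < f (u, θ₀ + ε / 2) :=
    (by fun_prop : Continuous fun u => f (u, θ₀ + ε / 2)).continuousAt.eventually (lt_mem_nhds h2)
  -- Tube lemma: the whole segment stays in `O`, so the zero given by the intermediate value theorem
  -- does too, wherever it falls.
  have e3 : ∀ᶠ u in 𝓝 u₀, ∀ θ ∈ Icc (θ₀ - ε / 2) (θ₀ + ε / 2), (u, θ) ∈ O := by
    refine isCompact_Icc.eventually_forall_of_forall_eventually fun θ hθ => ?_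
    exact hO.mem_nhds (hball θ (hin θ hθ)).2
  filter_upwards [e1, e2, e3] with u hu1 hu2 hu3
  obtain ⟨θ, hθ, hθ0⟩ := intermediate_value_Icc (by linarith : θ₀ - ε / 2 ≤ θ₀ + ε / 2)
    (by fun_prop : Continuous fun θ => f (u, θ)).continuousOn ⟨hu1.le, hu2.le⟩
  exact ⟨θ, hu3 θ hθ, hθ0⟩

open MvPolynomial in
theorem vanishingIdeal_image_comp {ι κ : Type*} (f : κ → ι) (A : Set (ι → ℝ)) :
    vanishingIdeal ℝ ((fun a : ι → ℝ => a ∘ f) '' A) =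
      (vanishingIdeal ℝ A).comap (rename f : MvPolynomial κ ℝ →ₐ[ℝ] MvPolynomial ι ℝ) := by
  ext p
  simp only [mem_vanishingIdeal_iff, forall_mem_image, Ideal.mem_comap, aeval_rename]

open MvPolynomial in
/-- The polynomials in one variable over a polynomial ring, as functions on affine space. -/
noncomputable def evalOption {σ : Type*} (a : Option σ → ℝ) :
    Polynomial (MvPolynomial σ ℝ) →+* ℝ :=
  (Polynomial.evalRingHom (a none)).comp (Polynomial.mapRingHom (eval (a ∘ some)))

open MvPolynomial in
theorem evalOption_optionEquivLeft {σ : Type*} (a : Option σ → ℝ)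
    (p : MvPolynomial (Option σ) ℝ) : evalOption a (optionEquivLeft ℝ σ p) = eval a p := by
  have h := optionEquivLeft_elim_eval ℝ σ (a ∘ some) (a none) p
  have ha : (fun x : Option σ => Option.elim x (a none) (a ∘ some)) = a := by
    funext x; cases x <;> rfl
  rw [ha] at h
  exact h.symm

open MvPolynomial in
@[simp] theorem evalOption_C {σ : Type*} (a : Option σ → ℝ) (p : MvPolynomial σ ℝ) :
    evalOption a (Polynomial.C p) = eval (a ∘ some) p := by
  simp [evalOption]

theorem continuous_evalOption {σ : Type*} (F : Polynomial (MvPolynomial σ ℝ)) :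
    Continuous fun a : Option σ → ℝ => evalOption a F := by
  obtain ⟨p, rfl⟩ := (MvPolynomial.optionEquivLeft ℝ σ).surjective F
  simp only [evalOption_optionEquivLeft]
  exact MvPolynomial.continuous_eval p

theorem evalOption_eq_zero_of_coeff {σ : Type*} {a : Option σ → ℝ}
    {F : Polynomial (MvPolynomial σ ℝ)} (h : ∀ i, MvPolynomial.eval (a ∘ some) (F.coeff i) = 0) :
    evalOption a F = 0 := by
  have : F.map (MvPolynomial.eval (a ∘ some)) = 0 := by
    ext i
    simp [h]
  simp [evalOption, this]

theorem Polynomial.C_coeff_mem_of_forall_C_leadingCoeff_mem {R : Type*} [CommRing R]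
    {q : Ideal (Polynomial R)} (hq : ∀ F ∈ q, Polynomial.C F.leadingCoeff ∈ q)
    {F : Polynomial R} (hF : F ∈ q) (i : ℕ) : Polynomial.C (F.coeff i) ∈ q := by
  induction hd : F.degree using WellFoundedLT.induction generalizing F with
  | ind d ih =>
    subst hd
    by_cases hF0 : F = 0
    · simp [hF0]
    have hmon : Polynomial.monomial F.natDegree F.leadingCoeff ∈ q := by
      rw [← Polynomial.C_mul_X_pow_eq_monomial]
      exact q.mul_mem_right _ (hq F hF)
    have hE : F.eraseLead ∈ q := by
      rw [← Polynomial.self_sub_monomial_natDegree_leadingCoeff]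
      exact q.sub_mem hF hmon
    by_cases hi : i = F.natDegree
    · rw [hi]
      exact hq F hF
    · rw [← Polynomial.eraseLead_coeff_of_ne i hi]
      exact ih _ (Polynomial.degree_eraseLead_lt hF0) hE rfl

open MvPolynomial in
/-- The projection along one coordinate of an irreducible locally algebraic set contains a
locally algebraic set with the same Zariski closure. -/
theorem IsLocallyAlgebraic.exists_subset_image_some {σ : Type*} {A : Set (Option σ → ℝ)}
    (hA : IsLocallyAlgebraic A) (hp : (vanishingIdeal ℝ A).IsPrime) :
    ∃ A' ⊆ (fun a : Option σ → ℝ => a ∘ some) '' A, IsLocallyAlgebraic A' ∧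
      vanishingIdeal ℝ A' = vanishingIdeal ℝ ((fun a : Option σ → ℝ => a ∘ some) '' A) := by
  obtain ⟨O, hO, hAO⟩ := hA.exists_isOpen_eq
  let π : (Option σ → ℝ) → σ → ℝ := fun a => a ∘ some
  let e := optionEquivLeft ℝ σ
  let q : Ideal (Polynomial (MvPolynomial σ ℝ)) :=
    (vanishingIdeal ℝ A).comap (e.symm : Polynomial (MvPolynomial σ ℝ) →+* MvPolynomial (Option σ) ℝ)
  have hq : q.IsPrime := Ideal.IsPrime.comap _
  have hmem : ∀ F, F ∈ q ↔ ∀ a ∈ A, evalOption a F = 0 := fun F => by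
    obtain ⟨p, rfl⟩ := e.surjective F
    simp only [q, Ideal.mem_comap, e, evalOption_optionEquivLeft]
    simp [aeval_eq_eval]
  have hmemC : ∀ g, Polynomial.C g ∈ q ↔ g ∈ vanishingIdeal ℝ (π '' A) := fun g => by
    rw [hmem]
    simp [π, aeval_eq_eval]
  have hAmem : ∀ a ∈ O, (∀ F ∈ q, evalOption a F = 0) → a ∈ A := fun a haO ha => by
    rw [hAO]
    refine ⟨haO, fun p hpA => ?_⟩
    rw [← evalOption_optionEquivLeft]
    refine ha _ ((hmem _).2 fun b hb => ?_)
    rw [evalOption_optionEquivLeft]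
    exact hpA b hb
  let V : Set (σ → ℝ) := {u | ∀ g ∈ vanishingIdeal ℝ (π '' A), eval u g = 0}
  -- `V` is the Zariski closure of the projection, and `Q ∩ V` is by construction a locally
  -- algebraic subset of the projection. What remains is that it is Zariski dense in `V`.
  let Q : Set (σ → ℝ) := interior {u | u ∈ V → u ∈ π '' A}
  let pt : (σ → ℝ) × ℝ → Option σ → ℝ := fun z x => Option.elim x z.2 z.1
  have hpt : Continuous pt := by
    refine continuous_pi fun x => ?_
    cases x
    · exact continuous_snd
    · exact (continuous_apply _).comp continuous_fst
  have hpta : ∀ a, pt (π a, a none) = a := fun a => by funext x; cases x <;> rfl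
  have hptO : ∀ a ∈ A, pt (π a, a none) ∈ O := fun a ha => by
    rw [hpta]
    exact (hAO ▸ ha : a ∈ O ∩ _).1
  -- It suffices that `π a ∈ Q` off the zeros of some `h ∉ q`: if `g` vanishes on `Q ∩ V`, then `g *
  -- h` vanishes on `A`, and primality gives `g ∈ q`.
  obtain ⟨h, hhq, hhQ⟩ : ∃ h, h ∉ q ∧ ∀ a ∈ A, evalOption a h ≠ 0 → π a ∈ Q := by
    by_cases hcase : ∀ F ∈ q, Polynomial.C F.leadingCoeff ∈ q
    -- Here all coefficients of elements of `q` lie in `q`, so `A` is open in the cylinder over `V`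
    -- and no exceptional locus is needed.
    · refine ⟨1, (Ideal.ne_top_iff_one q).1 hq.ne_top, fun a ha _ => ?_⟩
      have hcoeff : ∀ F ∈ q, ∀ i, Polynomial.C (F.coeff i) ∈ q := by
        intro F hF i
        exact Polynomial.C_coeff_mem_of_forall_C_leadingCoeff_mem hcase hF i
      rw [mem_interior_iff_mem_nhds]
      have hev : ∀ᶠ u in 𝓝 (π a), pt (u, a none) ∈ O :=
        (hO.preimage (hpt.comp (by fun_prop : Continuous fun u : σ → ℝ => (u, a none)))).mem_nhds
          (hptO a ha)
      filter_upwards [hev] with u hu huV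
      refine ⟨pt (u, a none), hAmem _ hu fun F hF => ?_, rfl⟩
      exact evalOption_eq_zero_of_coeff fun i => huV _ ((hmemC _).1 (hcoeff F hF i))
    · push Not at hcase
      -- Here the last coordinate is algebraic over the others, and `F` plays the role of its
      -- minimal polynomial. Where `F.leadingCoeff * F'` is nonzero, the root is simple and persists
      -- over nearby `u`.
      obtain ⟨F, ⟨hFq, hFlc⟩, hFmin⟩ := (measure Polynomial.natDegree).wf.has_min
        {F : Polynomial (MvPolynomial σ ℝ) | F ∈ q ∧ Polynomial.C F.leadingCoeff ∉ q} hcase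
      have hmin : ∀ G ∈ q, Polynomial.C G.leadingCoeff ∉ q → F.natDegree ≤ G.natDegree :=
        fun G hG hG' => not_lt.1 (hFmin G ⟨hG, hG'⟩)
      have hdeg : F.natDegree ≠ 0 := fun h0 => by
        rw [Polynomial.eq_C_of_natDegree_eq_zero h0] at hFq hFlc
        simp at hFlc
        exact hFlc hFq
      have hder : Polynomial.derivative F ∉ q := fun hd => by
        have hlt := Polynomial.natDegree_derivative_lt hdeg
        have hnd : Polynomial.C (Polynomial.derivative F).leadingCoeff ∈ q := by
          by_contra hn
          exact absurd (hmin _ hd hn) (not_le.2 hlt)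
        have hlead : (Polynomial.derivative F).leadingCoeff =
            F.leadingCoeff * C (F.natDegree : ℝ) := by
          simp
        rw [hlead, Polynomial.C_mul] at hnd
        refine (hq.mem_or_mem hnd).elim hFlc fun hn => hq.ne_top
          (Ideal.eq_top_of_isUnit_mem _ hn ?_)
        exact ((IsUnit.mk0 (F.natDegree : ℝ) (Nat.cast_ne_zero.2 hdeg)).map C).map Polynomial.C
      refine ⟨Polynomial.C F.leadingCoeff * Polynomial.derivative F,
        fun hmul => (hq.mem_or_mem hmul).elim hFlc hder, fun a ha hne => ?_⟩
      rw [map_mul, mul_ne_zero_iff, evalOption_C] at hne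
      rw [mem_interior_iff_mem_nhds]
      have hroot : ∀ᶠ u in 𝓝 (π a), ∃ θ, pt (u, θ) ∈ O ∧ evalOption (pt (u, θ)) F = 0 := by
        refine eventually_exists_zero_of_hasDerivAt (f := fun z => evalOption (pt z) F)
          (θ₀ := a none) (c := evalOption a (Polynomial.derivative F)) (O := pt ⁻¹' O)
          ((continuous_evalOption F).comp hpt) ?_ ?_ hne.2 (hO.preimage hpt) (hptO a ha)
        · have := (F.map (eval (π a))).hasDerivAt (a none)
          rw [Polynomial.derivative_map] at this
          exact this
        · rw [hpta]
          exact (hmem F).1 hFq a ha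
      have hlc : ∀ᶠ u in 𝓝 (π a), eval u F.leadingCoeff ≠ 0 :=
        (continuous_eval _).continuousAt.eventually_ne hne.1
      filter_upwards [hroot, hlc] with u ⟨θ, hθO, hθ⟩ hu huV
      refine ⟨pt (u, θ), hAmem _ hθO fun G hG => ?_, rfl⟩
      -- Over a point `u` of `V` the pseudo-remainder vanishes identically, so at a root of `F`
      -- every `G ∈ q` vanishes as soon as the leading coefficient of `F` does not.
      obtain ⟨N, H, hNH⟩ := Polynomial.exists_pseudoDiv q hFq hmin G hG
      have h1 := evalOption_eq_zero_of_coeff (a := pt (u, θ)) fun i => huV _ ((hmemC _).1 (hNH i))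
      rw [map_sub, map_mul, map_mul, hθ, mul_zero, sub_zero, evalOption_C, map_pow] at h1
      exact (mul_eq_zero.1 h1).resolve_left (pow_ne_zero _ hu)
  have hsub : Q ∩ V ⊆ π '' A := fun u hu => interior_subset hu.1 hu.2
  refine ⟨Q ∩ V, hsub, ⟨_, Q, isOpen_interior, rfl⟩,
    le_antisymm ?_ (vanishingIdeal_anti_mono hsub)⟩
  intro g hg
  rw [← hmemC]
  refine (hq.mem_or_mem (x := Polynomial.C g) (y := h) ((hmem _).2 fun a ha => ?_)).resolve_right hhq
  rw [map_mul]
  by_cases h0 : evalOption a h = 0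
  · rw [h0, mul_zero]
  · rw [evalOption_C]
    have : eval (π a) g = 0 := hg (π a) ⟨hhQ a ha h0, fun g' hg' => hg' _ ⟨a, ha, rfl⟩⟩
    rw [show a ∘ some = π a from rfl, this, zero_mul]

theorem image_comp_equiv_eq {ι κ : Type*} (e : κ ≃ ι) (A : Set (ι → ℝ)) :
    (fun a : ι → ℝ => a ∘ e) '' A = {x : κ → ℝ | x ∘ e.symm ∈ A} := by
  ext x
  constructor
  · rintro ⟨a, ha, rfl⟩
    simpa [Function.comp_assoc] using ha
  · intro hx
    exact ⟨_, hx, by simp [Function.comp_assoc]⟩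

theorem IsLocallyAlgebraic.image_comp_equiv {ι κ : Type*} {A : Set (ι → ℝ)}
    (hA : IsLocallyAlgebraic A) (e : κ ≃ ι) :
    IsLocallyAlgebraic ((fun a : ι → ℝ => a ∘ e) '' A) := by
  rw [image_comp_equiv_eq]
  exact hA.preimage_comp e.symm

open MvPolynomial in
theorem isPrime_vanishingIdeal_image_comp {ι κ : Type*} {A : Set (ι → ℝ)}
    (hA : (vanishingIdeal ℝ A).IsPrime) (f : κ → ι) :
    (vanishingIdeal ℝ ((fun a : ι → ℝ => a ∘ f) '' A)).IsPrime := by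
  rw [vanishingIdeal_image_comp]
  exact Ideal.IsPrime.comap _

open MvPolynomial in
/-- A coordinate projection of an irreducible locally algebraic set contains a locally algebraic
set with the same Zariski closure. -/
theorem IsLocallyAlgebraic.exists_subset_image_inl {κ γ : Type*} [Finite γ]
    {A : Set (κ ⊕ γ → ℝ)} (hA : IsLocallyAlgebraic A) (hp : (vanishingIdeal ℝ A).IsPrime) :
    ∃ A' ⊆ (fun a : κ ⊕ γ → ℝ => a ∘ Sum.inl) '' A, IsLocallyAlgebraic A' ∧
      vanishingIdeal ℝ A' = vanishingIdeal ℝ ((fun a : κ ⊕ γ → ℝ => a ∘ Sum.inl) '' A) := by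
  induction γ using Finite.induction_empty_option with
  | of_equiv e ih =>
    let e' := Equiv.sumCongr (Equiv.refl κ) e
    have := ih (hA.image_comp_equiv e') (isPrime_vanishingIdeal_image_comp hp e')
    rwa [image_image] at this
  | h_empty =>
    exact ⟨_, subset_rfl, hA.image_comp_equiv (Equiv.sumEmpty κ PEmpty).symm, rfl⟩
  | h_option ih =>
    rename_i γ' _
    let e : Option (κ ⊕ γ') ≃ κ ⊕ Option γ' :=
      { toFun := fun x => Option.elim x (Sum.inr none) (Sum.map id some)
        invFun := Sum.elim (fun k => some (Sum.inl k)) (Option.map Sum.inr)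
        left_inv := by rintro (_ | _ | _) <;> rfl
        right_inv := by rintro (_ | _ | _) <;> rfl }
    have hpe := isPrime_vanishingIdeal_image_comp hp e
    obtain ⟨A₁, hA₁s, hA₁, hA₁v⟩ := (hA.image_comp_equiv e).exists_subset_image_some hpe
    have hp₁ : (vanishingIdeal ℝ A₁).IsPrime := by
      rw [hA₁v]
      exact isPrime_vanishingIdeal_image_comp hpe some
    obtain ⟨A₂, hA₂s, hA₂, hA₂v⟩ := ih hA₁ hp₁
    have him : (fun a : κ ⊕ Option γ' → ℝ => a ∘ Sum.inl) '' A =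
        (fun a : κ ⊕ γ' → ℝ => a ∘ Sum.inl) ''
        ((fun a : Option (κ ⊕ γ') → ℝ => a ∘ some) ''
          ((fun a : κ ⊕ Option γ' → ℝ => a ∘ e) '' A)) := by
      rw [image_image, image_image]
      rfl
    refine ⟨A₂, ?_, hA₂, ?_⟩
    · rw [him]
      exact hA₂s.trans (image_mono hA₁s)
    · rw [hA₂v, him, vanishingIdeal_image_comp, hA₁v, ← vanishingIdeal_image_comp]

/-! ### Tame sets and interiors of their projections -/

/-- A finite union of locally algebraic sets. -/
def IsTame {ι : Type*} (A : Set (ι → ℝ)) : Prop :=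
  ∃ T : Set (Set (ι → ℝ)), T.Finite ∧ (∀ B ∈ T, IsLocallyAlgebraic B) ∧ A = ⋃₀ T

theorem IsLocallyAlgebraic.isTame {ι : Type*} {A : Set (ι → ℝ)} (hA : IsLocallyAlgebraic A) :
    IsTame A :=
  ⟨{A}, finite_singleton A, by simpa using hA, by simp⟩

namespace IsTame

variable {ι κ : Type*}

theorem union {A B : Set (ι → ℝ)} (hA : IsTame A) (hB : IsTame B) : IsTame (A ∪ B) := by
  obtain ⟨S, hS, hS', rfl⟩ := hA
  obtain ⟨T, hT, hT', rfl⟩ := hB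
  exact ⟨S ∪ T, hS.union hT, fun B hB => hB.elim (hS' B) (hT' B), (sUnion_union S T).symm⟩

theorem inter {A B : Set (ι → ℝ)} (hA : IsTame A) (hB : IsTame B) : IsTame (A ∩ B) := by
  obtain ⟨S, hS, hS', rfl⟩ := hA
  obtain ⟨T, hT, hT', rfl⟩ := hB
  refine ⟨image2 (· ∩ ·) S T, hS.image2 _ hT, ?_, ?_⟩
  · rintro _ ⟨B, hB, C, hC, rfl⟩
    exact (hS' B hB).inter (hT' C hC)
  · ext x
    simp only [mem_inter_iff, mem_sUnion, mem_image2]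
    constructor
    · rintro ⟨⟨B, hB, hxB⟩, C, hC, hxC⟩
      exact ⟨_, ⟨B, hB, C, hC, rfl⟩, hxB, hxC⟩
    · rintro ⟨_, ⟨B, hB, C, hC, rfl⟩, hxB, hxC⟩
      exact ⟨⟨B, hB, hxB⟩, C, hC, hxC⟩

open MvPolynomial in
theorem exists_isPrime_vanishingIdeal [Finite ι] {A : Set (ι → ℝ)} (hA : IsTame A)
    {f : κ → ι} (hf : ZariskiDense ((fun a : ι → ℝ => a ∘ f) '' A)) :
    ∃ A' ⊆ A, IsLocallyAlgebraic A' ∧ (vanishingIdeal ℝ A').IsPrime ∧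
      ZariskiDense ((fun a : ι → ℝ => a ∘ f) '' A') := by
  obtain ⟨T, hT, hT', rfl⟩ := hA
  have := hT.to_subtype
  obtain ⟨B, hB⟩ := hf.exists_of_subset_iUnion (α := T)
    (T := fun B => (fun a : ι → ℝ => a ∘ f) '' B) (by rw [sUnion_eq_iUnion, image_iUnion])
  obtain ⟨A', h1, h2⟩ := (hT' B B.2).exists_isPrime_vanishingIdeal hB
  exact ⟨A', h1.trans (subset_sUnion_of_mem B.2), h2⟩

open MvPolynomial in
/-- A Zariski dense coordinate projection of a finite union of locally algebraic sets has
nonempty interior. -/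
theorem interior_image_nonempty [Finite ι] {A : Set (ι → ℝ)} (hA : IsTame A)
    {f : κ → ι} (hf : ZariskiDense ((fun a : ι → ℝ => a ∘ f) '' A)) :
    (interior ((fun a : ι → ℝ => a ∘ f) '' A)).Nonempty := by
  obtain ⟨B, hBA, hB, hBp, hBf⟩ := hA.exists_isPrime_vanishingIdeal hf
  have hinj := hf.injective_of_image_comp
  classical
  let e : κ ⊕ ↥(range f)ᶜ ≃ ι := (Equiv.sumCongr (Equiv.ofInjective f hinj) (Equiv.refl _)).trans
    (Equiv.Set.sumCompl (range f))
  have he : e ∘ Sum.inl = f := by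
    funext k
    simp [e]
  obtain ⟨A', hA's, hA', hA'v⟩ :=
    (hB.image_comp_equiv e).exists_subset_image_inl (isPrime_vanishingIdeal_image_comp hBp e)
  rw [image_image] at hA's hA'v
  simp only [Function.comp_assoc, he] at hA's hA'v
  -- Density of the projection means that no equation survives, and a locally algebraic set with
  -- zero vanishing ideal is open.
  have hv : vanishingIdeal ℝ A' = ⊥ := by
    rw [hA'v, eq_bot_iff]
    exact fun p hp => hBf p hp
  obtain ⟨O, hO, hA'O⟩ := hA'.exists_isOpen_eq
  have hAeq : A' = O := by
    rw [hA'O, hv]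
    simp
  have hne : A'.Nonempty := by
    by_contra h
    rw [not_nonempty_iff_eq_empty] at h
    rw [h, vanishingIdeal_empty] at hv
    exact bot_ne_top hv.symm
  obtain ⟨x, hx⟩ := hne
  exact ⟨x, mem_interior.2 ⟨A', hA's.trans (image_mono hBA), hAeq ▸ hO, hx⟩⟩

end IsTame

/-! ### Upper bound for the dimension of a family -/

/-- A transcendence basis contained in a generating set which is the union of two parts, and
which is adapted to the first part. -/
theorem AlgebraicIndependent.exists_adapted_basis {k R β φ : Type*} [Field k] [CommRing R]
    [IsDomain R] [Algebra k R] [Finite β] [Finite φ] (x : β ⊕ φ → R)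
    (hx : Algebra.adjoin k (range x) = ⊤) {d : ℕ} {y : Fin d → R}
    (hy : AlgebraicIndependent k y) :
    ∃ (I : Set β) (J : Set φ),
      AlgebraicIndependent k (fun c : I ⊕ J => x (Sum.map (↑) (↑) c)) ∧
      (∀ b : β, ¬ AlgebraicIndependent k
        fun o : Option I => x (Sum.inl (Option.elim o b (↑)))) ∧
      d ≤ Nat.card (I ⊕ J) := by
  obtain ⟨I, hI⟩ := (Set.toFinite {I : Set β | AlgebraicIndependent k
    fun i : I => x (Sum.inl i)}).exists_maximal
    ⟨∅, algebraicIndependent_empty_type_iff.2 (algebraMap k R).injective⟩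
  have hImax : ∀ b : β, ¬ AlgebraicIndependent k
      fun o : Option I => x (Sum.inl (Option.elim o b (↑))) := by
    intro b hb
    -- If `b` already lies in `I`, the extended family repeats an element and cannot be independent.
    have hbI : b ∉ I := fun hbI => by
      have := hb.injective (a₁ := none) (a₂ := some ⟨b, hbI⟩) rfl
      simp at this
    have h1 : AlgebraicIndependent k fun i : ↥(insert b I) => x (Sum.inl i) := by
      classical
      let g : ↥(insert b I) → Option I := fun i => if h : (i : β) ∈ I then some ⟨i, h⟩ else none
      have hg : ∀ i, Option.elim (g i) b (↑) = (i : β) := by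
        intro i
        by_cases h : (i : β) ∈ I
        · simp [g, h]
        · have := i.2.resolve_right h
          simp [g, this, hbI]
      have hginj : Function.Injective g := fun i j hij => by
        apply Subtype.ext
        rw [← hg i, ← hg j, hij]
      have := hb.comp g hginj
      simpa only [Function.comp_def, hg] using this
    exact hbI (hI.2 h1 (subset_insert b I) (mem_insert b I))
  have halg : Algebra.IsAlgebraic (Algebra.adjoin k (range x)) R :=
    ⟨fun a => isAlgebraic_algebraMap
      (⟨a, hx ▸ Algebra.mem_top⟩ : Algebra.adjoin k (range x))⟩
  let s : Set R := range fun i : I => x (Sum.inl i)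
  obtain ⟨D, hsD, hDx, hD⟩ := exists_isTranscendenceBasis_between (R := k) s (range x)
    (by rintro _ ⟨i, rfl⟩; exact ⟨_, rfl⟩) hI.1.to_subtype_range
  -- By maximality of `I`, the elements that complete `s` to a transcendence basis can only come
  -- from the second part.
  have hDs : ∀ c : ↥(D \ s), ∃ j : φ, x (Sum.inr j) = c := by
    rintro ⟨c, hcD, hcs⟩
    obtain ⟨b | j, hbj⟩ := hDx hcD
    · refine absurd ?_ (hImax b)
      let g : Option I → D := fun o => Option.elim o ⟨c, hcD⟩ fun i => ⟨_, hsD ⟨i, rfl⟩⟩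
      have hg : Function.Injective g := by
        rintro (_ | i) (_ | j) hij
        · rfl
        · exact absurd ⟨j, congrArg Subtype.val hij.symm⟩ hcs
        · exact absurd ⟨i, congrArg Subtype.val hij⟩ hcs
        · exact congrArg some (hI.1.injective (congrArg Subtype.val hij))
      have h1 := hD.1.comp g hg
      convert h1 using 1
      funext o
      cases o
      · exact hbj
      · rfl
    · exact ⟨j, hbj⟩
  choose σ hσ using hDs
  let g : I ⊕ range σ → D := Sum.elim (fun i => ⟨_, hsD ⟨i, rfl⟩⟩)
    fun j => ⟨x (Sum.inr j), by
      obtain ⟨_, c, rfl⟩ := j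
      rw [hσ]
      exact c.2.1⟩
  have hg : Function.Bijective g := by
    constructor
    · rintro (i | ⟨_, c, rfl⟩) (j | ⟨_, c', rfl⟩) hij
      · exact congrArg Sum.inl (hI.1.injective (congrArg Subtype.val hij))
      · have h1 : x (Sum.inl i) = x (Sum.inr (σ c')) := congrArg Subtype.val hij
        rw [hσ] at h1
        exact absurd ⟨i, h1⟩ c'.2.2
      · have h1 : x (Sum.inr (σ c)) = x (Sum.inl j) := congrArg Subtype.val hij
        rw [hσ] at h1
        exact absurd ⟨j, h1.symm⟩ c.2.2
      · have h1 : x (Sum.inr (σ c)) = x (Sum.inr (σ c')) := congrArg Subtype.val hij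
        rw [hσ, hσ] at h1
        have : c = c' := Subtype.ext h1
        subst this
        rfl
    · rintro ⟨c, hc⟩
      by_cases hcs : c ∈ s
      · obtain ⟨i, hi⟩ := hcs
        exact ⟨Sum.inl i, Subtype.ext hi⟩
      · exact ⟨Sum.inr ⟨_, ⟨c, hc, hcs⟩, rfl⟩, Subtype.ext (hσ _)⟩
  refine ⟨I, range σ, ?_, hImax, ?_⟩
  · have h1 := hD.1.comp g hg.1
    convert h1 using 1
    funext c
    rcases c with i | j <;> rfl
  · rw [Nat.card_eq_of_bijective g hg]
    have hDf : Finite D := (finite_range x).subset hDx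
    have h1 := hy.lift_cardinalMk_le_trdeg
    rw [← hD.cardinalMk_eq_trdeg, ← Nat.cast_card (α := D)] at h1
    simpa using h1

open MvPolynomial in
/-- For a locally algebraic family, the dimension of the total space is at most the dimension of
the base plus the maximal dimension of the fibers. -/
theorem HasCoordDim.le_add_of_fibers {β φ : Type*} [Finite β] [Finite φ] {M : Set (β ⊕ φ → ℝ)}
    (hM : IsTame M) {b e d : ℕ}
    (hb : ¬ HasCoordDim (b + 1) ((fun v : β ⊕ φ → ℝ => v ∘ Sum.inl) '' M))
    (he : ∀ y : β → ℝ, ¬ HasCoordDim (e + 1) {z : φ → ℝ | Sum.elim y z ∈ M})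
    (hd : HasCoordDim d M) : d ≤ b + e := by
  obtain ⟨f, hf⟩ := hd
  obtain ⟨B, hBM, hB, hBp, hBf⟩ := hM.exists_isPrime_vanishingIdeal hf
  obtain ⟨I, J, hIJ, hImax, hdc⟩ :=
    (ZariskiDense.image_comp_iff_algebraicIndependent.1 hBf).exists_adapted_basis
      (fun i => Ideal.Quotient.mkₐ ℝ (vanishingIdeal ℝ B) (X i)) (by
        have : (range fun i => Ideal.Quotient.mkₐ ℝ (vanishingIdeal ℝ B) (X i)) =
            Ideal.Quotient.mkₐ ℝ (vanishingIdeal ℝ B) '' range X := by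
          rw [← range_comp]; rfl
        rw [this, ← AlgHom.map_adjoin, adjoin_range_X, Algebra.map_top]
        exact (AlgHom.range_eq_top _).2 (Ideal.Quotient.mkₐ_surjective _ _))
  rw [← ZariskiDense.image_comp_iff_algebraicIndependent] at hIJ
  rw [Nat.card_sum] at hdc
  have hI : Nat.card I ≤ b := by
    by_contra! hlt
    refine hb (HasCoordDim.of_card_le (κ := I) (f := (↑)) hlt ?_)
    rw [image_image]
    refine ZariskiDense.mono ?_ (image_mono hBM)
    have := hIJ.image_comp (g := Sum.inl) Sum.inl_injective
    rwa [image_image] at this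
  by_contra! hlt
  have hJ : e + 1 ≤ Nat.card J := by omega
  simp only [← ZariskiDense.image_comp_iff_algebraicIndependent (ι := β ⊕ φ)] at hImax
  unfold ZariskiDense at hImax
  push Not at hImax
  choose p hp hp0 using hImax
  -- On `B` every base coordinate is a root of a nonzero polynomial over the coordinates in `I`.
  -- Fixing these at a value `u` where no leading coefficient vanishes leaves finitely many base
  -- points.
  let P : β → Polynomial (MvPolynomial I ℝ) := fun k => optionEquivLeft ℝ I (p k)
  have hP0 : ∀ k, P k ≠ 0 := fun k => by
    simpa [P] using hp0 k
  obtain ⟨w, hw⟩ := hB.isTame.interior_image_nonempty hIJ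
  set N := (fun a : β ⊕ φ → ℝ => a ∘ Sum.map ((↑) : I → β) ((↑) : J → φ)) '' B
  have hc1 : Continuous fun u : I → ℝ => Sum.elim u (w ∘ Sum.inr) := by
    refine continuous_pi fun i => ?_
    rcases i with i | i
    · exact continuous_apply i
    · exact continuous_const
  have hU : ZariskiDense {u : I → ℝ | Sum.elim u (w ∘ Sum.inr) ∈ interior N} := by
    refine ZariskiDense.of_interior_nonempty ⟨w ∘ Sum.inl, mem_interior.2
      ⟨_, subset_rfl, isOpen_interior.preimage hc1, ?_⟩⟩
    simpa using hw
  cases nonempty_fintype β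
  obtain ⟨u, huN, hu⟩ : ∃ u : I → ℝ, Sum.elim u (w ∘ Sum.inr) ∈ interior N ∧
      ∀ k, eval u (P k).leadingCoeff ≠ 0 := by
    by_contra! hcon
    refine Finset.prod_ne_zero_iff.2 (fun k _ => Polynomial.leadingCoeff_ne_zero.2 (hP0 k))
      (hU (∏ k, (P k).leadingCoeff) fun u hu => ?_)
    obtain ⟨k, hk⟩ := hcon u hu
    rw [map_prod]
    exact Finset.prod_eq_zero (Finset.mem_univ k) hk
  have hPu : ∀ k, (P k).map (eval u) ≠ 0 := fun k h0 => by
    refine hu k ?_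
    have := congrArg (fun q => q.coeff (P k).natDegree) h0
    simpa using this
  have hc2 : Continuous fun z : J → ℝ => Sum.elim u z := by
    refine continuous_pi fun i => ?_
    rcases i with i | i
    · exact continuous_const
    · exact continuous_apply i
  have hV : ZariskiDense {z : J → ℝ | Sum.elim u z ∈ N} := by
    refine ZariskiDense.of_interior_nonempty ⟨w ∘ Sum.inr, mem_interior.2
      ⟨{z | Sum.elim u z ∈ interior N}, fun z hz => interior_subset (s := N) hz,
        isOpen_interior.preimage hc2, huN⟩⟩
  -- The slice of `N` over `u` is Zariski dense and is covered by projections of the fibers of `M`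
  -- over the finite set `F`. One fiber thus has a dense projection to the coordinates in `J`, more
  -- than `e` of them.
  let F : Set (β → ℝ) := Set.pi univ fun k => {r | ((P k).map (eval u)).IsRoot r}
  have hF : F.Finite := Set.Finite.pi fun k => Polynomial.finite_setOfPred_isRoot (hPu k)
  have := hF.to_subtype
  obtain ⟨y, hy⟩ := hV.exists_of_subset_iUnion (α := F)
    (T := fun y => (fun z : φ → ℝ => z ∘ ((↑) : J → φ)) '' {z : φ → ℝ | Sum.elim y z ∈ M}) (by
      rintro z ⟨v, hv, hvz⟩
      have hvI : v ∘ Sum.inl ∘ ((↑) : I → β) = u := funext fun i => congrFun hvz (Sum.inl i)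
      have hvJ : v ∘ Sum.inr ∘ ((↑) : J → φ) = z := funext fun j => congrFun hvz (Sum.inr j)
      refine mem_iUnion.2 ⟨⟨v ∘ Sum.inl, fun k _ => ?_⟩, v ∘ Sum.inr, hBM ?_, hvJ⟩
      · have h1 := hp k _ ⟨v, hv, rfl⟩
        rw [← evalOption_optionEquivLeft] at h1
        rw [← hvI]
        exact h1
      · simpa using hv)
  exact he y (HasCoordDim.of_card_le hJ hy)

/-! ### Semialgebraic sets in coordinates -/

section Semialgebraic

variable {E ι : Type*} [AddCommGroup E] [Module ℝ E] [Finite ι]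

theorem exists_mvPolynomial_eval_eq (ψ : (ι → ℝ) →ₗ[ℝ] E) {f : E → ℝ}
    (hf : f ∈ Algebra.adjoin ℝ (range fun (l : E →ₗ[ℝ] ℝ) (x : E) => l x)) :
    ∃ p : MvPolynomial ι ℝ, ∀ x, f (ψ x) = MvPolynomial.eval x p := by
  cases nonempty_fintype ι
  classical
  induction hf using Algebra.adjoin_induction with
  | mem f hf =>
    obtain ⟨l, rfl⟩ := hf
    refine ⟨∑ i, MvPolynomial.C (l (ψ (Pi.single i 1))) * MvPolynomial.X i, fun x => ?_⟩
    conv_lhs => rw [pi_eq_sum_univ' x]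
    simp [mul_comm]
  | algebraMap r => exact ⟨MvPolynomial.C r, fun x => by simp⟩
  | add f g _ _ hf hg =>
    obtain ⟨p, hp⟩ := hf
    obtain ⟨q, hq⟩ := hg
    exact ⟨p + q, fun x => by simp [hp, hq]⟩
  | mul f g _ _ hf hg =>
    obtain ⟨p, hp⟩ := hf
    obtain ⟨q, hq⟩ := hg
    exact ⟨p * q, fun x => by simp [hp, hq]⟩

theorem IsSemialgebraic.isTame_preimage {A : Set E} (hA : IsSemialgebraic A)
    (ψ : (ι → ℝ) →ₗ[ℝ] E) : IsTame (ψ ⁻¹' A) := by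
  -- The complement is carried along because tameness is only known to be stable under unions and
  -- intersections.
  suffices IsTame (ψ ⁻¹' A) ∧ IsTame (ψ ⁻¹' A)ᶜ from this.1
  induction hA with
  | pos f hf =>
    obtain ⟨p, hp⟩ := exists_mvPolynomial_eval_eq ψ hf
    have hc := MvPolynomial.continuous_eval p
    constructor
    · have : ψ ⁻¹' {x | 0 < f x} = {x | 0 < MvPolynomial.eval x p} := by
        ext x
        simp [hp]
      rw [this]
      exact (IsLocallyAlgebraic.of_isOpen (isOpen_lt continuous_const hc)).isTame
    · have : (ψ ⁻¹' {x | 0 < f x})ᶜ =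
          {x | MvPolynomial.eval x p = 0} ∪ {x | MvPolynomial.eval x p < 0} := by
        ext x
        simp [hp, le_iff_eq_or_lt]
      rw [this]
      exact (IsLocallyAlgebraic.zeros p).isTame.union
        (IsLocallyAlgebraic.of_isOpen (isOpen_lt hc continuous_const)).isTame
  | compl A _ ih => exact ⟨ih.2, by simpa using ih.1⟩
  | union A B _ _ ihA ihB =>
    rw [preimage_union, compl_union]
    exact ⟨ihA.1.union ihB.1, ihA.2.inter ihB.2⟩

theorem IsSemialgebraic.inter {A B : Set E} (hA : IsSemialgebraic A) (hB : IsSemialgebraic B) :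
    IsSemialgebraic (A ∩ B) := by
  rw [← compl_compl (A ∩ B), compl_inter]
  exact .compl _ (.union _ _ (.compl _ hA) (.compl _ hB))

end Semialgebraic

/-! ### Comparison with Hausdorff dimension -/

/-- The dense projection to `k` coordinates contains an open set, hence has Hausdorff dimension `k`,
and coordinate projections are Lipschitz. -/
theorem IsTame.natCast_le_dimH {ι : Type*} [Fintype ι] {A : Set (ι → ℝ)} (hA : IsTame A) {k : ℕ}
    (hk : HasCoordDim k A) : (k : ENNReal) ≤ dimH A := by
  obtain ⟨f, hf⟩ := hk
  have h1 := Real.dimH_of_nonempty_interior (hA.interior_image_nonempty hf)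
  rw [Module.finrank_fin_fun] at h1
  rw [← h1]
  have hl : LipschitzWith 1 fun a : ι → ℝ => a ∘ f :=
    LipschitzWith.of_dist_le_mul fun a b => by
      rw [NNReal.coe_one, one_mul]
      exact (dist_pi_le_iff dist_nonneg).2 fun i => dist_le_pi_dist a b (f i)
  exact hl.dimH_image_le A

/-! ### Level sets of submersions -/

section LevelSets

variable {E : Type*} [NormedAddCommGroup E] [NormedSpace ℝ E] [FiniteDimensional ℝ E]

/-- Near each point, `A` lies in the image, under the locally Lipschitz implicit function, of a
piece of the kernel of `g'`, a space of dimension `finrank ℝ E - r`. Hausdorff dimension is local,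
so this suffices. -/
theorem dimH_le_of_forall_exists_submersion {A : Set E} {r : ℕ}
    (h : ∀ x ∈ A, ∃ (g : E → Fin r → ℝ) (g' : E →L[ℝ] Fin r → ℝ), HasStrictFDerivAt g g' x ∧
      Function.Surjective g' ∧ ∀ᶠ y in 𝓝[A] x, g y = g x) :
    dimH A ≤ ((finrank ℝ E - r : ℕ) : ENNReal) := by
  by_contra! hlt
  have : ProperSpace E := FiniteDimensional.proper_real E
  obtain ⟨x, hxA, hx⟩ := exists_mem_nhdsWithin_lt_dimH_of_lt_dimH hlt
  obtain ⟨g, g', hg, hsurj, hgA⟩ := h x hxA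
  have hr : g'.range = ⊤ := LinearMap.range_eq_top.2 hsurj
  let Φ := hg.implicitToOpenPartialHomeomorph g g' hr
  let η := hg.implicitFunction g g' hr (g x)
  obtain ⟨K, s, hs, hK⟩ := (hg.to_implicitFunction hr).exists_lipschitzOnWith
  have hΦ : ContinuousAt (fun y => (Φ y).2) x :=
    (Φ.continuousAt (hg.mem_implicitToOpenPartialHomeomorph_source hr)).snd
  have hΦx : (Φ x).2 = 0 := by
    simp [Φ]
  have hev : ∀ᶠ y in 𝓝[A] x, y ∈ η '' s := by
    have h1 : ∀ᶠ y in 𝓝[A] x, (Φ y).2 ∈ s :=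
      nhdsWithin_le_nhds (hΦ.preimage_mem_nhds (by rwa [hΦx]))
    have h2 := nhdsWithin_le_nhds (s := A) (hg.eq_implicitFunction hr)
    filter_upwards [h1, h2, hgA] with y hy1 hy2 hy3
    refine ⟨(Φ y).2, hy1, ?_⟩
    change hg.implicitFunction g g' hr (g x) _ = y
    rw [← hy3]
    exact hy2
  refine absurd (hx _ hev) (not_lt.2 ?_)
  have hfin : finrank ℝ g'.ker = finrank ℝ E - r := by
    have := LinearMap.finrank_range_add_finrank_ker (g' : E →ₗ[ℝ] Fin r → ℝ)
    rw [LinearMap.range_eq_top.2 hsurj, finrank_top, Module.finrank_fin_fun] at this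
    change finrank ℝ (LinearMap.ker (g' : E →ₗ[ℝ] Fin r → ℝ)) = _
    omega
  calc dimH (η '' s) ≤ dimH s := hK.dimH_image_le
    _ ≤ dimH (univ : Set g'.ker) := dimH_mono (subset_univ s)
    _ = _ := by rw [Real.dimH_univ_eq_finrank, hfin]

theorem IsC1Submanifold.dimH_le {d : ℕ} {A : Set E} (hA : IsC1Submanifold d A) : dimH A ≤ d := by
  rcases A.eq_empty_or_nonempty with rfl | ⟨x₀, hx₀⟩
  · simp
  obtain ⟨m₀, -, -, hm₀, -⟩ := hA x₀ hx₀
  have : d = finrank ℝ E - m₀ := by omega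
  rw [this]
  refine dimH_le_of_forall_exists_submersion fun x hx => ?_
  obtain ⟨m, O, g, hm, hO, hxO, hg, hsurj, hAO⟩ := hA x hx
  obtain rfl : m = m₀ := by omega
  refine ⟨g, fderiv ℝ g x, (hg.contDiffAt (hO.mem_nhds hxO)).hasStrictFDerivAt one_ne_zero,
    hsurj, ?_⟩
  have hz : ∀ y ∈ A ∩ O, g y = 0 := fun y hy => by
    rw [hAO] at hy
    exact hy.2
  filter_upwards [self_mem_nhdsWithin, nhdsWithin_le_nhds (hO.mem_nhds hxO)] with y hyA hyO
  rw [hz y ⟨hyA, hyO⟩, hz x ⟨hx, hxO⟩]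

/-- Each vector `v` in the kernel of the differential of a defining submersion is the velocity of a
curve in `A`, the image under the implicit function of `s ↦ s • v`. This inclusion is all that the
rank bound for orbit maps needs. -/
theorem IsC1Submanifold.le_finrank_tangentSpaceOf {d : ℕ} {A : Set E} (hA : IsC1Submanifold d A)
    {x : E} (hx : x ∈ A) : d ≤ finrank ℝ (tangentSpaceOf A x) := by
  obtain ⟨m, O, g, hm, hO, hxO, hgO, hsurj, hAO⟩ := hA x hx
  have hg : HasStrictFDerivAt g (fderiv ℝ g x) x :=
    (hgO.contDiffAt (hO.mem_nhds hxO)).hasStrictFDerivAt one_ne_zero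
  have hgx : g x = 0 := by
    have : x ∈ A ∩ O := ⟨hx, hxO⟩
    rw [hAO] at this
    exact this.2
  have hr : (fderiv ℝ g x).range = ⊤ := LinearMap.range_eq_top.2 hsurj
  let η := hg.implicitFunction g _ hr (g x)
  have hη := hg.to_implicitFunction hr
  have hη0 : η 0 = x := hg.implicitFunction_apply_image hr
  have hηA : ∀ᶠ z in 𝓝 (0 : (fderiv ℝ g x).ker), η z ∈ A := by
    have h1 : ∀ᶠ z in 𝓝 (0 : (fderiv ℝ g x).ker), g (η z) = g x :=
      (Continuous.tendsto' (f := fun z : (fderiv ℝ g x).ker => (g x, z)) (by fun_prop) 0 _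
        rfl).eventually (hg.map_implicitFunction_eq hr)
    have h2 : ∀ᶠ z in 𝓝 (0 : (fderiv ℝ g x).ker), η z ∈ O :=
      hη.continuousAt.preimage_mem_nhds (hO.mem_nhds (by rwa [← hη0] at hxO))
    filter_upwards [h1, h2] with z hz1 hz2
    have : η z ∈ A ∩ O := by
      rw [hAO]
      exact ⟨hz2, hz1.trans hgx⟩
    exact this.1
  have hle : LinearMap.ker (fderiv ℝ g x : E →ₗ[ℝ] Fin m → ℝ) ≤ tangentSpaceOf A x := by
    intro v hv
    refine Submodule.subset_span ?_
    let v' : (fderiv ℝ g x).ker := ⟨v, hv⟩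
    have hd : HasDerivAt (fun s : ℝ => η (s • v')) v 0 := by
      have h1 : HasDerivAt (fun s : ℝ => s • v') v' 0 := by
        simpa using (hasDerivAt_id (0 : ℝ)).smul_const v'
      have h2 := hη.hasFDerivAt
      rw [← zero_smul ℝ v'] at h2
      exact h2.comp_hasDerivAt (0 : ℝ) h1
    have hcont : Filter.Tendsto (fun s : ℝ => s • v') (𝓝 0) (𝓝 0) :=
      Continuous.tendsto' (by fun_prop) 0 _ (zero_smul ℝ v')
    have hd0 : η ((0 : ℝ) • v') = x := by rw [zero_smul, hη0]
    refine mem_tangentConeAt_of_seq (𝓝[≠] (0 : ℝ)) (fun s => s⁻¹)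
      (fun s => η (s • v') - x) ?_ ?_ ?_
    · have := hd.continuousAt.tendsto.sub_const x
      rw [hd0, sub_self] at this
      exact this.mono_left nhdsWithin_le_nhds
    · have := hcont.eventually hηA
      filter_upwards [nhdsWithin_le_nhds this] with s hs
      simpa using hs
    · have := hasDerivAt_iff_tendsto_slope_zero.1 hd
      simpa [hη0] using this
  have hfin : finrank ℝ (LinearMap.ker (fderiv ℝ g x : E →ₗ[ℝ] Fin m → ℝ)) = d := by
    have := LinearMap.finrank_range_add_finrank_ker (fderiv ℝ g x : E →ₗ[ℝ] Fin m → ℝ)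
    rw [LinearMap.range_eq_top.2 hsurj, finrank_top, Module.finrank_fin_fun] at this
    omega
  rw [← hfin]
  exact Submodule.finrank_mono hle

/-- A level set of a `C¹` map of rank at least `d` has codimension at least `d`. -/
theorem dimH_level_le_of_le_finrank_range {F : Type*} [NormedAddCommGroup F] [NormedSpace ℝ F]
    [FiniteDimensional ℝ F] {U : Set E} (hU : IsOpen U) {G : E → F} (hG : ContDiffOn ℝ 1 G U)
    {d : ℕ} (hd : ∀ t ∈ U, d ≤ finrank ℝ (LinearMap.range (fderiv ℝ G t : E →ₗ[ℝ] F))) (w : F) :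
    dimH {t ∈ U | G t = w} ≤ ((finrank ℝ E - d : ℕ) : ENNReal) := by
  refine dimH_le_of_forall_exists_submersion fun t ht => ?_
  let D : E →ₗ[ℝ] F := fderiv ℝ G t
  -- The rank may exceed `d` and vary with `t`. Composing with a linear map onto `ℝ ^ d` that is
  -- onto from the range of `D` gives a submersion, still constant on the level set.
  obtain ⟨L, hL⟩ : ∃ L : F →ₗ[ℝ] Fin d → ℝ, Function.Surjective (L.comp D) := by
    obtain ⟨q, hq⟩ : ∃ q : LinearMap.range D →ₗ[ℝ] Fin d → ℝ, Function.Surjective q :=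
      ⟨(LinearMap.funLeft ℝ ℝ (Fin.castLE (hd t ht.1))).comp
        (finBasis ℝ (LinearMap.range D)).equivFun.toLinearMap,
        by
          rw [LinearMap.coe_comp]
          exact (LinearMap.funLeft_surjective_of_injective ℝ ℝ _ (Fin.castLE_injective _)).comp
            (finBasis ℝ (LinearMap.range D)).equivFun.surjective⟩
    obtain ⟨L, hL⟩ := q.exists_extend
    refine ⟨L, fun z => ?_⟩
    obtain ⟨⟨_, y, rfl⟩, hy⟩ := hq z
    refine ⟨y, ?_⟩
    rw [← hy, ← hL]
    rfl
  let L' : F →L[ℝ] Fin d → ℝ := LinearMap.toContinuousLinearMap L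
  refine ⟨fun y => L' (G y), L'.comp (fderiv ℝ G t), ?_, hL, ?_⟩
  · exact L'.hasStrictFDerivAt.comp t
      ((hG.contDiffAt (hU.mem_nhds ht.1)).hasStrictFDerivAt one_ne_zero)
  · filter_upwards [self_mem_nhdsWithin] with y hy
    rw [hy.2, ht.2]

end LevelSets

/-! ### Fibers of tame sets and nonvanishing loci -/

open MvPolynomial in
theorem IsLocallyAlgebraic.fiber {β φ : Type*} {A : Set (β ⊕ φ → ℝ)} (hA : IsLocallyAlgebraic A)
    (y : β → ℝ) : IsLocallyAlgebraic {z : φ → ℝ | Sum.elim y z ∈ A} := by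
  obtain ⟨s, O, hO, rfl⟩ := hA
  let h : MvPolynomial (β ⊕ φ) ℝ →ₐ[ℝ] MvPolynomial φ ℝ := aeval (Sum.elim (fun i => C (y i)) X)
  have hh : ∀ z p, eval z (h p) = eval (Sum.elim y z) p := by
    intro z p
    have : ((eval z).comp (h : MvPolynomial (β ⊕ φ) ℝ →+* MvPolynomial φ ℝ))
        = eval (Sum.elim y z) := by
      refine ringHom_ext (fun r => ?_) fun i => ?_
      · simp [h]
      · rcases i with i | i <;> simp [h]
    exact congrArg (fun k => k p) this
  have hc : Continuous fun z : φ → ℝ => Sum.elim y z := by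
    refine continuous_pi fun i => ?_
    rcases i with i | i
    · exact continuous_const
    · exact continuous_apply i
  refine ⟨h '' s, {z | Sum.elim y z ∈ O}, hO.preimage hc, ?_⟩
  ext z
  simp [hh]

theorem IsTame.fiber {β φ : Type*} {A : Set (β ⊕ φ → ℝ)} (hA : IsTame A) (y : β → ℝ) :
    IsTame {z : φ → ℝ | Sum.elim y z ∈ A} := by
  obtain ⟨T, hT, hT', rfl⟩ := hA
  refine ⟨(fun B => {z : φ → ℝ | Sum.elim y z ∈ B}) '' T, hT.image _, ?_, ?_⟩
  · rintro _ ⟨B, hB, rfl⟩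
    exact (hT' B hB).fiber y
  · ext z
    simp

theorem eval_coord_mem_adjoin {E ι : Type*} [AddCommGroup E] [Module ℝ E] (φ : E →ₗ[ℝ] (ι → ℝ))
    (q : MvPolynomial ι ℝ) : (fun t => MvPolynomial.eval (φ t) q) ∈
      Algebra.adjoin ℝ (range fun (l : E →ₗ[ℝ] ℝ) (x : E) => l x) := by
  induction q using MvPolynomial.induction_on with
  | C r =>
    simp only [MvPolynomial.eval_C]
    exact Subalgebra.algebraMap_mem (Algebra.adjoin ℝ _) r
  | add p q hp hq =>
    simp only [map_add]
    exact Subalgebra.add_mem _ hp hq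
  | mul_X p i hp =>
    simp only [map_mul, MvPolynomial.eval_X]
    exact Subalgebra.mul_mem _ hp
      (Algebra.subset_adjoin (mem_range_self ((LinearMap.proj i).comp φ)))

theorem isSemialgebraic_eval_coord_ne_zero {E ι : Type*} [AddCommGroup E] [Module ℝ E]
    (φ : E →ₗ[ℝ] (ι → ℝ)) (q : MvPolynomial ι ℝ) :
    IsSemialgebraic {t | MvPolynomial.eval (φ t) q ≠ 0} := by
  have : {t | MvPolynomial.eval (φ t) q ≠ 0} = {t | 0 < MvPolynomial.eval (φ t) (q ^ 2)} := by
    ext t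
    simp [sq_pos_iff]
  rw [this]
  exact .pos _ (eval_coord_mem_adjoin φ (q ^ 2))

/-! ### Submersive families -/

section Families

variable {𝕜 : Type*} [RCLike 𝕜] {n : ℕ}

/-- Real coordinates on the parameter space. -/
noncomputable def paramCoord (𝕜 : Type*) [RCLike 𝕜] (n : ℕ) :
    (Fin (n + 1) → 𝕜) ≃ₗ[ℝ] (Fin (finrank ℝ (Fin (n + 1) → 𝕜)) → ℝ) :=
  (finBasis ℝ (Fin (n + 1) → 𝕜)).equivFun

/-- Real coordinates on the space of matrices. -/
noncomputable def matCoord (𝕜 : Type*) [RCLike 𝕜] (n : ℕ) :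
    MatSpace 𝕜 n ≃ₗ[ℝ] (Fin (finrank ℝ (MatSpace 𝕜 n)) → ℝ) :=
  (finBasis ℝ (MatSpace 𝕜 n)).equivFun

/-- The incidence argument: with `m` parameters, dense fibers of dimension `k` would give `k + m ≤ z
+ w + (m - d)`, against `z + w < k + d`. -/
theorem not_zariskiDense_excess {U : Set (Fin (n + 1) → 𝕜)} (hUo : IsOpen U)
    (hU0 : (0 : Fin (n + 1) → 𝕜) ∈ U)
    {Ψ : (Fin (n + 1) → 𝕜) → ProjSpace 𝕜 n → ProjSpace 𝕜 n} (hΨs : IsSemialgebraicFamily U Ψ)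
    {S : Set (ProjSpace 𝕜 n)} (hS : IsProjSemialgebraic S) {d : ℕ}
    (hSd : IsC1Submanifold d (projEmb '' S)) (hSne : S.Nonempty) (hΨ : IsSubmersiveFamily U S Ψ)
    {Z W : Set (ProjSpace 𝕜 n)} (hZ : IsProjSemialgebraic Z) (hW : IsProjSemialgebraic W)
    {z w k : ℕ} (hz : ¬ HasCoordDim (z + 1) (matCoord 𝕜 n '' (projEmb '' (Z ∩ S))))
    (hw : ¬ HasCoordDim (w + 1) (matCoord 𝕜 n '' (projEmb '' (W ∩ S)))) (hk : z + w < k + d) :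
    ¬ ZariskiDense (paramCoord 𝕜 n '' {t ∈ U | HasCoordDim k
      (matCoord 𝕜 n '' (projEmb '' (Z ∩ Ψ t ⁻¹' W ∩ S)))}) := by
  intro hdense
  let μ := Fin (finrank ℝ (MatSpace 𝕜 n))
  let τ := Fin (finrank ℝ (Fin (n + 1) → 𝕜))
  let pt : ((μ ⊕ μ) ⊕ τ → ℝ) →ₗ[ℝ] (Fin (n + 1) → 𝕜) :=
    (paramCoord 𝕜 n).symm.toLinearMap.comp (LinearMap.funLeft ℝ ℝ Sum.inr)
  let px : ((μ ⊕ μ) ⊕ τ → ℝ) →ₗ[ℝ] MatSpace 𝕜 n :=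
    (matCoord 𝕜 n).symm.toLinearMap.comp (LinearMap.funLeft ℝ ℝ (Sum.inl ∘ Sum.inl))
  let py : ((μ ⊕ μ) ⊕ τ → ℝ) →ₗ[ℝ] MatSpace 𝕜 n :=
    (matCoord 𝕜 n).symm.toLinearMap.comp (LinearMap.funLeft ℝ ℝ (Sum.inl ∘ Sum.inr))
  let M : Set ((μ ⊕ μ) ⊕ τ → ℝ) :=
    (pt.prod (px.prod py)) ⁻¹' {p | p.1 ∈ U ∧ ∃ x, p.2.1 = projEmb x ∧ p.2.2 = projEmb (Ψ p.1 x)} ∩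
      (px ⁻¹' (projEmb '' (Z ∩ S)) ∩ py ⁻¹' (projEmb '' (W ∩ S)))
  have hMtame : IsTame M := by
    have hZS : IsSemialgebraic (projEmb '' (Z ∩ S)) := by
      rw [image_inter projEmb_injective]
      exact hZ.inter hS
    have hWS : IsSemialgebraic (projEmb '' (W ∩ S)) := by
      rw [image_inter projEmb_injective]
      exact hW.inter hS
    exact (IsSemialgebraic.isTame_preimage hΨs _).inter
      ((hZS.isTame_preimage _).inter (hWS.isTame_preimage _))
  have hsmooth : ∀ x ∈ S, ContDiffOn ℝ 1 (fun t => projEmb (Ψ t x)) U := by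
    intro x hx
    obtain ⟨G, hG, hGΨ⟩ := hΨ.smooth
    have h1 : ContDiffOn ℝ 1 (fun t => G (t, projEmb x)) U :=
      hG.comp (contDiff_id.prodMk contDiff_const).contDiffOn
        fun t ht => ⟨ht, mem_image_of_mem _ hx⟩
    exact h1.congr fun t ht => (hGΨ t ht x hx).symm
  have hrank : ∀ x ∈ S, ∀ t ∈ U, d ≤ finrank ℝ (LinearMap.range
      (fderiv ℝ (fun τ => projEmb (Ψ τ x)) t : (Fin (n + 1) → 𝕜) →ₗ[ℝ] MatSpace 𝕜 n)) := by
    intro x hx t ht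
    rw [hΨ.submersive t ht x hx]
    exact hSd.le_finrank_tangentSpaceOf (mem_image_of_mem _ (hΨ.mapsTo t ht hx))
  -- Needed so that the truncated difference `m - d` in the fiber bound is the true one.
  have hdm : d ≤ finrank ℝ (Fin (n + 1) → 𝕜) := by
    obtain ⟨x, hx⟩ := hSne
    exact (hrank x hx 0 hU0).trans (LinearMap.finrank_range_le _)
  have hbase : ¬ HasCoordDim (z + w + 1) ((fun v : (μ ⊕ μ) ⊕ τ → ℝ => v ∘ Sum.inl) '' M) := by
    intro h
    have := h.of_prod (a := z) (b := w)
      (fun h' => hz (h'.mono (by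
        rintro _ ⟨_, ⟨v, hv, rfl⟩, rfl⟩
        exact ⟨px v, hv.2.1, by simp [px]; rfl⟩)))
      (fun h' => hw (h'.mono (by
        rintro _ ⟨_, ⟨v, hv, rfl⟩, rfl⟩
        exact ⟨py v, hv.2.2, by simp [py]; rfl⟩)))
    omega
  have hfib : ∀ y : μ ⊕ μ → ℝ, ¬ HasCoordDim (finrank ℝ (Fin (n + 1) → 𝕜) - d + 1)
      {t : τ → ℝ | Sum.elim y t ∈ M} := by
    intro y hy
    obtain ⟨t₀, ht₀⟩ : {t : τ → ℝ | Sum.elim y t ∈ M}.Nonempty := by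
      obtain ⟨f, hf⟩ := hy
      exact image_nonempty.1 hf.nonempty
    obtain ⟨x, hx, hxy⟩ := ht₀.2.1
    have hle := (hMtame.fiber y).natCast_le_dimH hy
    let Y : MatSpace 𝕜 n := (matCoord 𝕜 n).symm (y ∘ Sum.inr)
    have hsub : {t : τ → ℝ | Sum.elim y t ∈ M} ⊆
        (paramCoord 𝕜 n).toContinuousLinearEquiv '' {t ∈ U | projEmb (Ψ t x) = Y} := by
      intro t ht
      obtain ⟨x', hx', hY⟩ := ht.1.2
      have hxx : x = x' := projEmb_injective (hxy.trans hx')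
      subst hxx
      exact ⟨(paramCoord 𝕜 n).symm t, ⟨ht.1.1, hY.symm⟩, by simp⟩
    have hle2 := dimH_level_le_of_le_finrank_range hUo (hsmooth x hx.2) (hrank x hx.2) Y
    have hle3 := (hle.trans (dimH_mono hsub)).trans
      ((ContinuousLinearEquiv.dimH_image _ _).le.trans hle2)
    have := Nat.cast_le.1 hle3
    omega
  have hbig : HasCoordDim (k + Nat.card τ) M := by
    refine HasCoordDim.of_fibers (hdense.mono ?_)
    rintro _ ⟨t, ⟨htU, ht⟩, rfl⟩
    refine HasCoordDim.of_image_comp (g := Sum.inl) (ht.mono ?_)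
    rintro _ ⟨_, ⟨x, hx, rfl⟩, rfl⟩
    refine ⟨Sum.elim (matCoord 𝕜 n (projEmb x)) (matCoord 𝕜 n (projEmb (Ψ t x))), ?_, by simp⟩
    have ept : ∀ a b : μ → ℝ, pt (Sum.elim (Sum.elim a b) (paramCoord 𝕜 n t)) = t := fun a b =>
      (paramCoord 𝕜 n).symm_apply_apply t
    have epx : ∀ (b : μ → ℝ) (c : τ → ℝ),
        px (Sum.elim (Sum.elim (matCoord 𝕜 n (projEmb x)) b) c) = projEmb x := fun b c =>
      (matCoord 𝕜 n).symm_apply_apply _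
    have epy : ∀ (a : μ → ℝ) (c : τ → ℝ),
        py (Sum.elim (Sum.elim a (matCoord 𝕜 n (projEmb (Ψ t x)))) c) = projEmb (Ψ t x) :=
      fun a c => (matCoord 𝕜 n).symm_apply_apply _
    refine ⟨⟨?_, x, epx _ _, ?_⟩, ?_, ?_⟩
    · change pt _ ∈ U
      rwa [ept]
    · change py _ = projEmb (Ψ (pt _) x)
      rw [ept, epy]
    · rw [mem_preimage, epx]
      exact ⟨x, ⟨hx.1.1, hx.2⟩, rfl⟩
    · rw [mem_preimage, epy]
      exact ⟨_, ⟨hx.1.2, hΨ.mapsTo t htU hx.2⟩, rfl⟩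
  have := hbig.le_add_of_fibers hMtame hbase hfib
  simp only [τ, Nat.card_fin] at this
  omega

theorem exists_mvPolynomial_projDim_le {U : Set (Fin (n + 1) → 𝕜)} (hUo : IsOpen U)
    (hU0 : (0 : Fin (n + 1) → 𝕜) ∈ U)
    {Ψ : (Fin (n + 1) → 𝕜) → ProjSpace 𝕜 n → ProjSpace 𝕜 n} (hΨs : IsSemialgebraicFamily U Ψ)
    {S : Set (ProjSpace 𝕜 n)} (hS : IsProjSemialgebraic S) {d : ℕ}
    (hSd : IsC1Submanifold d (projEmb '' S)) (hΨ : IsSubmersiveFamily U S Ψ)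
    {Z W : Set (ProjSpace 𝕜 n)} (hZ : IsProjSemialgebraic Z) (hW : IsProjSemialgebraic W) :
    ∃ q : MvPolynomial (Fin (finrank ℝ (Fin (n + 1) → 𝕜))) ℝ, q ≠ 0 ∧
      ∀ t ∈ U, MvPolynomial.eval (paramCoord 𝕜 n t) q ≠ 0 →
        projDim (Z ∩ Ψ t ⁻¹' W ∩ S) + projDim S ≤ projDim (Z ∩ S) + projDim (W ∩ S) := by
  by_cases hne : (Z ∩ S).Nonempty ∧ (W ∩ S).Nonempty
  swap
  · refine ⟨1, one_ne_zero, fun t ht _ => ?_⟩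
    have : Z ∩ Ψ t ⁻¹' W ∩ S = ∅ := by
      by_contra h
      obtain ⟨x, hx⟩ := nonempty_iff_ne_empty.2 h
      exact hne ⟨⟨x, hx.1.1, hx.2⟩, ⟨Ψ t x, hx.1.2, hΨ.mapsTo t ht hx.2⟩⟩
    rw [this, projDim, image_empty, semialgDim_empty, WithBot.bot_add]
    exact bot_le
  obtain ⟨hZne, hWne⟩ := hne
  have hSne : S.Nonempty := hZne.mono inter_subset_right
  obtain ⟨z, hz, -, hz1⟩ := exists_semialgDim_eq_natCast (matCoord 𝕜 n) (hZne.image projEmb)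
  obtain ⟨w, hw, -, hw1⟩ := exists_semialgDim_eq_natCast (matCoord 𝕜 n) (hWne.image projEmb)
  obtain ⟨s, hs, hs0, -⟩ := exists_semialgDim_eq_natCast (matCoord 𝕜 n) (hSne.image projEmb)
  -- The Krull dimension of `S` is compared with its manifold dimension through `dimH`. Only this
  -- inequality matters, since `projDim S` stands on the smaller side.
  have hsd : s ≤ d := by
    have htame : IsTame (matCoord 𝕜 n '' (projEmb '' S)) := by
      rw [LinearEquiv.image_eq_preimage_symm]
      exact hS.isTame_preimage (matCoord 𝕜 n).symm.toLinearMap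
    have h1 := htame.natCast_le_dimH hs0
    have h2 : dimH (matCoord 𝕜 n '' (projEmb '' S)) ≤ d :=
      (ContinuousLinearEquiv.dimH_image (matCoord 𝕜 n).toContinuousLinearEquiv _).le.trans
        hSd.dimH_le
    exact Nat.cast_le.1 (h1.trans h2)
  -- `z + w + 1 - d` is the first excessive dimension. When the subtraction truncates to `0`, every
  -- nonempty intersection is excessive, so generically the intersection is empty.
  have hnd := not_zariskiDense_excess hUo hU0 hΨs hS hSd hSne hΨ hZ hW hz1 hw1
    (k := z + w + 1 - d) (by omega)
  unfold ZariskiDense at hnd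
  push Not at hnd
  obtain ⟨q, hq, hq0⟩ := hnd
  refine ⟨q, hq0, fun t ht htq => ?_⟩
  rcases (Z ∩ Ψ t ⁻¹' W ∩ S).eq_empty_or_nonempty with h | h
  · rw [h, projDim, image_empty, semialgDim_empty, WithBot.bot_add]
    exact bot_le
  obtain ⟨c, hc, hc0, -⟩ := exists_semialgDim_eq_natCast (matCoord 𝕜 n) (h.image projEmb)
  have hck : c < z + w + 1 - d := by
    by_contra! hle
    exact htq (hq _ ⟨t, ⟨ht, hc0.of_le hle⟩, rfl⟩)
  simp only [projDim, hz, hw, hs, hc]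
  have : c + s ≤ z + w := by omega
  exact_mod_cast this

end Families

theorem mainTheorem3 {𝕜 : Type*} [RCLike 𝕜] (n : ℕ)
    (𝒮 : Set (Set (ProjSpace 𝕜 n))) (h𝒮 : IsAlgebraicStratification 𝒮)
    (U : Set (Fin (n + 1) → 𝕜)) (hUo : IsOpen U) (hU0 : (0 : Fin (n + 1) → 𝕜) ∈ U)
    (hUs : IsSemialgebraic U)
    (Ψ : (Fin (n + 1) → 𝕜) → ProjSpace 𝕜 n → ProjSpace 𝕜 n)
    (hΨs : IsSemialgebraicFamily U Ψ)
    (hΨ : ∀ S ∈ 𝒮, IsSubmersiveFamily U S Ψ)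
    (hΨ0 : ∀ x, Ψ 0 x = x)
    (Z W : Set (ProjSpace 𝕜 n)) (hZ : IsProjSemialgebraic Z) (hW : IsProjSemialgebraic W) :
    ∃ U' : Set (Fin (n + 1) → 𝕜), U' ⊆ U ∧ IsOpen U' ∧ U ⊆ closure U' ∧ IsSemialgebraic U' ∧
      ∀ t ∈ U', ∀ S ∈ 𝒮,
        projDim (Z ∩ Ψ t ⁻¹' W ∩ S) + projDim S ≤ projDim (Z ∩ S) + projDim (W ∩ S) := by
  have hq : ∀ S : 𝒮, ∃ q : MvPolynomial (Fin (finrank ℝ (Fin (n + 1) → 𝕜))) ℝ, q ≠ 0 ∧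
      ∀ t ∈ U, MvPolynomial.eval (paramCoord 𝕜 n t) q ≠ 0 →
        projDim (Z ∩ Ψ t ⁻¹' W ∩ S) + projDim (S : Set (ProjSpace 𝕜 n)) ≤
          projDim (Z ∩ S) + projDim (W ∩ S) := fun S => by
    obtain ⟨d, hd⟩ := h𝒮.smooth S S.2
    exact exists_mvPolynomial_projDim_le hUo hU0 hΨs (h𝒮.semialgebraic S S.2) hd (hΨ S S.2) hZ hW
  choose q hq0 hq using hq
  have := h𝒮.finite.fintype
  let Q := ∏ S, q S
  have hQ0 : Q ≠ 0 := Finset.prod_ne_zero_iff.2 fun S _ => hq0 S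
  have hcont : Continuous (paramCoord 𝕜 n) := (paramCoord 𝕜 n).toContinuousLinearEquiv.continuous
  have hcont' : Continuous (paramCoord 𝕜 n).symm :=
    (paramCoord 𝕜 n).toContinuousLinearEquiv.symm.continuous
  refine ⟨U ∩ {t | MvPolynomial.eval (paramCoord 𝕜 n t) Q ≠ 0}, inter_subset_left, ?_, ?_, ?_, ?_⟩
  · exact hUo.inter (isOpen_ne_fun ((MvPolynomial.continuous_eval Q).comp hcont) continuous_const)
  · intro t ht
    rw [mem_closure_iff]
    intro O hO htO
    -- A nonzero polynomial cannot vanish on a nonempty open set, so `Q ≠ 0` somewhere in every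
    -- neighborhood of `t`.
    have hzd : ZariskiDense ((paramCoord 𝕜 n).symm ⁻¹' (O ∩ U)) := by
      refine ZariskiDense.of_interior_nonempty ⟨paramCoord 𝕜 n t, ?_⟩
      rw [((hO.inter hUo).preimage hcont').interior_eq]
      simpa using ⟨htO, ht⟩
    by_contra hemp
    refine hQ0 (hzd Q fun v hv => ?_)
    by_contra hv0
    exact hemp ⟨(paramCoord 𝕜 n).symm v, hv.1, hv.2, by simpa using hv0⟩
  · exact hUs.inter (isSemialgebraic_eval_coord_ne_zero (paramCoord 𝕜 n).toLinearMap Q)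
  · rintro t ⟨htU, htQ⟩ S hS
    refine hq ⟨S, hS⟩ t htU fun h0 => htQ ?_
    rw [map_prod]
    exact Finset.prod_eq_zero (Finset.mem_univ (⟨S, hS⟩ : 𝒮)) h0
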